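/- **Coin flipping.** A (quantum) coin flipping protocol with $N$ rounds between Alice and Bob consists of $N$ rounds, each being one quantum message from Alice to Bob followed by one quantum message from Bob to Alice; the players start with unentangled private memories, perform quantum operations between the messages, and at the end Alice outputs $c_A$ and Bob outputs $c_B$, both in $\{0,1,\mathrm{Abort}\}$ (all registers finite-dimensional). The output of the protocol is $c=c_A$ if $c_A=c_B$, and $c=\mathrm{Abort}$ otherwise. A cheating player may use an arbitrary strategy with the same message registers, ending with an arbitrary output; suprema below are over all strategies of the cheating player, the other player being honest. A *weak coin flipping protocol* $WCF(z,\varepsilon)$ is such a protocol in which, if both players are honest, $\Pr[c=0]=z$ ("Alice wins") and $\Pr[c=1]=1-z$ ("Bob wins"), while $\sup\Pr[c=0]\le z+\varepsilon$ when Alice cheats and $\sup\Pr[c=1]\le 1-z+\varepsilon$ when Bob cheats. A *strong coin flipping protocol* with bias $\delta$ is one in which, if both players are honest, $\Pr[c=0]=\Pr[c=1]=\tfrac12$, while $P_A^*\le \tfrac12+\delta$ and $P_B^*\le\tfrac12+\delta$; here $P_A^*$ (resp. $P_B^*$) is the supremum of $\max\{\Pr[c=0],\Pr[c=1]\}$ over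 all strategies of a cheating Alice (resp. Bob). **The protocol $S$.** Let $Q$ be a $WCF(z,\varepsilon)$ protocol with $N$ rounds and let $p\in[0,1]$. 1. Alice chooses a uniformly random bit $a$ and sends it to Bob (who answers with an empty message). 2. Alice and Bob perform $Q$. 3. Alice sends an empty message. If Bob's output in $Q$ is $1$ (Bob wins), he chooses a bit $b$ with $b=a$ with probability $p$ and $b=\bar a$ with probability $1-p$, sends $b$ to Alice, and outputs $c_B=b$; if it is $0$ (Alice wins), he outputs $c_B=a$; if it is Abort, he outputs Abort (in the last two cases he sends an irrelevant bit). An honest Alice outputs $c_A=a$, the received bit $c_A=b$, or Abort, if her output in $Q$ is $0$, $1$, or Abort, respectively. **Proposition.** Let $Q$ be a $WCF(z,\varepsilon)$ protocol with $N$ rounds, where $z+\varepsilon<2$, and put $$p=\max\Big\{0,\ \frac{1-z-\varepsilon}{2-z-\varepsilon}\Big\}\in[0,1].$$ Then the protocol $S$ with this $p$ has $N+2$ rounds of communication; if both players are honest, $\Pr[c=0]=\Pr[c=1]=\tfrac12$; and its cheating probabilities satisfy $$P_A^*\le\frac1{2-z-\varepsilon}\qquad\text{and}\qquad P_B^*\le\frac{2-z+\varepsilon}{2}.$$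 In particular $S$ is a strong coin flipping protocol with bias $\max\big\{\frac1{2-z-\varepsilon},\frac{2-z+\varepsilon}2\big\}-\frac12$. -/

import Mathlib

open Matrix
open scoped Kronecker BigOperators ComplexOrder

noncomputable section

namespace CoinFlip

/-! Two-party quantum protocols: finite registers, quantum operations, strategies. -/

/-- A finite-dimensional quantum register, given by the labels of its computational basis. -/
structure Reg where
  carrier : Type
  [fin : Fintype carrier]
  [dec : DecidableEq carrier]

attribute [instance] Reg.fin Reg.dec

instance : CoeSort Reg Type := ⟨Reg.carrier⟩

/-- The register whose basis is labelled by a given finite type. -/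
abbrev Reg.of (α : Type) [Fintype α] [DecidableEq α] : Reg := ⟨α⟩

/-- A density matrix: a positive semidefinite matrix of trace one. -/
structure Density (m : Type) [Fintype m] where
  mat : Matrix m m ℂ
  pos : mat.PosSemidef
  trace_eq_one : mat.trace = 1

/-- A quantum operation (completely positive, trace preserving), given by Kraus operators. -/
structure Channel (m n : Type) [Fintype m] [DecidableEq m] [Fintype n] where
  ι : Type
  [fin : Fintype ι]
  K : ι → Matrix n m ℂ
  complete : ∑ i, (K i)ᴴ * K i = 1

attribute [instance] Channel.fin

/-- Outputs of a player: `some 0`, `some 1`, or `none`, which stands for Abort. -/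
abbrev Outcome : Type := Option (Fin 2)

/-- A quantum measurement with values in `Outcome`, given by its measurement operators. -/
structure Measurement (m : Type) [Fintype m] [DecidableEq m] where
  M : Outcome → Matrix m m ℂ
  complete : ∑ o, (M o)ᴴ * M o = 1

section Operations

variable {m n k r : Type} [Fintype m] [DecidableEq m] [Fintype n] [DecidableEq n]
  [Fintype k] [DecidableEq k] [Fintype r] [DecidableEq r]

/-- Apply an operation to the first factor of a joint state. -/
def Channel.apply (Φ : Channel m n) (ρ : Matrix (m × r) (m × r) ℂ) :
    Matrix (n × r) (n × r) ℂ :=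
  ∑ i, (Φ.K i ⊗ₖ (1 : Matrix r r ℂ)) * ρ * (Φ.K i ⊗ₖ (1 : Matrix r r ℂ))ᴴ

/-- The operation `Φ ⊗ id` that leaves an additional register `r` untouched. -/
def Channel.tensorId (Φ : Channel m n) (r : Type) [Fintype r] [DecidableEq r] :
    Channel (m × r) (n × r) where
  ι := Φ.ι
  K i := Φ.K i ⊗ₖ (1 : Matrix r r ℂ)
  complete := by
    have h : ∀ i, (Φ.K i ⊗ₖ (1 : Matrix r r ℂ))ᴴ * (Φ.K i ⊗ₖ (1 : Matrix r r ℂ))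
        = ((Φ.K i)ᴴ * Φ.K i) ⊗ₖ (1 : Matrix r r ℂ) := by
      intro i
      rw [conjTranspose_kronecker, ← mul_kronecker_mul]
      simp
    simp_rw [h]
    rw [← one_kronecker_one, ← Φ.complete]
    ext ⟨a, b⟩ ⟨c, d⟩
    simp [Matrix.sum_apply, kroneckerMap_apply, Finset.sum_mul]

/-- Sequential composition: first `Φ`, then `Ψ`. -/
def Channel.andThen (Φ : Channel m n) (Ψ : Channel n k) : Channel m k where
  ι := Φ.ι × Ψ.ι
  K i := Ψ.K i.2 * Φ.K i.1
  complete := by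
    rw [Fintype.sum_prod_type]
    have h : ∀ i, ∑ j, (Ψ.K j * Φ.K i)ᴴ * (Ψ.K j * Φ.K i) = (Φ.K i)ᴴ * Φ.K i := by
      intro i
      calc _ = ∑ j, (Φ.K i)ᴴ * ((Ψ.K j)ᴴ * Ψ.K j) * Φ.K i := by
            simp [conjTranspose_mul, Matrix.mul_assoc]
        _ = (Φ.K i)ᴴ * (∑ j, (Ψ.K j)ᴴ * Ψ.K j) * Φ.K i := by
            rw [Matrix.mul_sum, Matrix.sum_mul]
        _ = _ := by rw [Ψ.complete, Matrix.mul_one]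
    simp_rw [h]
    exact Φ.complete

/-- Relabelling of the basis of the input and of the output register. -/
def Channel.reindex {m' n' : Type} [Fintype m'] [DecidableEq m'] [Fintype n']
    (Φ : Channel m n) (e : m' ≃ m) (f : n' ≃ n) : Channel m' n' where
  ι := Φ.ι
  K i := (Φ.K i).submatrix f e
  complete := by
    have h : ∀ i, ((Φ.K i).submatrix f e)ᴴ * (Φ.K i).submatrix f e
        = ((Φ.K i)ᴴ * Φ.K i).submatrix e e := by
      intro i
      rw [conjTranspose_submatrix, submatrix_mul_equiv]
    simp_rw [h]
    have h2 : ∑ i, ((Φ.K i)ᴴ * Φ.K i).submatrix e e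
        = (∑ i, (Φ.K i)ᴴ * Φ.K i).submatrix e e := by
      ext a b
      simp [Matrix.sum_apply]
    rw [h2, Φ.complete, submatrix_one_equiv]

/-- The identity operation. -/
def Channel.id (m : Type) [Fintype m] [DecidableEq m] : Channel m m where
  ι := Unit
  K _ := 1
  complete := by simp

/-- Classical randomized processing: read `s` in the computational basis and replace it by `t`
with probability `w s t`. -/
def Channel.classical (w : m → n → ℝ) (h0 : ∀ s t, 0 ≤ w s t) (h1 : ∀ s, ∑ t, w s t = 1) :
    Channel m n where
  ι := m × n
  K i := Matrix.single i.2 i.1 ((Real.sqrt (w i.1 i.2) : ℝ) : ℂ)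
  complete := by
    have h : ∀ i : m × n, (Matrix.single i.2 i.1 ((Real.sqrt (w i.1 i.2) : ℝ) : ℂ))ᴴ
        * Matrix.single i.2 i.1 ((Real.sqrt (w i.1 i.2) : ℝ) : ℂ)
        = Matrix.single i.1 i.1 ((w i.1 i.2 : ℝ) : ℂ) := by
      intro i
      rw [conjTranspose_single, single_mul_single_same]
      congr 1
      rw [Complex.star_def, Complex.conj_ofReal, ← Complex.ofReal_mul,
        Real.mul_self_sqrt (h0 _ _)]
    simp_rw [h]
    rw [Fintype.sum_prod_type]
    ext a b
    have hs : ∀ s, ∑ t, (Matrix.single s s ((w s t : ℝ) : ℂ) : Matrix m m ℂ)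
        = Matrix.single s s 1 := by
      intro s
      ext a b
      simp only [Matrix.sum_apply, Matrix.single_apply]
      split_ifs with hc
      · rw [← Complex.ofReal_sum, h1, Complex.ofReal_one]
      · simp
    simp_rw [hs]
    simp only [Matrix.sum_apply, Matrix.single_apply, Matrix.one_apply]
    by_cases hab : a = b
    · subst hab
      simp
    · rw [if_neg hab]
      apply Finset.sum_eq_zero
      intro s _
      rw [if_neg]
      rintro ⟨rfl, rfl⟩
      exact hab rfl

/-- Classical deterministic processing: read `s` in the computational basis and replace it
by `f s`. -/
def Channel.function (f : m → n) : Channel m n :=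
  Channel.classical (fun s t => if t = f s then 1 else 0)
    (by intro s t; split_ifs <;> norm_num) (by intro s; simp)

/-- Perform a measurement, store its result in an `Outcome` register, discard the rest. -/
def Measurement.record (E : Measurement m) : Channel m Outcome where
  ι := Outcome × m
  K i := Matrix.single i.1 i.2 (1 : ℂ) * E.M i.1
  complete := by
    rw [Fintype.sum_prod_type]
    have h : ∀ o : Outcome, ∑ j : m, (Matrix.single o j (1 : ℂ) * E.M o)ᴴ
        * (Matrix.single o j (1 : ℂ) * E.M o) = (E.M o)ᴴ * E.M o := by
      intro o
      have hj : ∀ j : m, (Matrix.single o j (1 : ℂ) * E.M o)ᴴ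
          * (Matrix.single o j (1 : ℂ) * E.M o)
          = (E.M o)ᴴ * Matrix.single j j (1 : ℂ) * E.M o := by
        intro j
        rw [conjTranspose_mul, conjTranspose_single, Matrix.mul_assoc,
          ← Matrix.mul_assoc (Matrix.single j o _), single_mul_single_same]
        simp [Matrix.mul_assoc]
      simp_rw [hj]
      rw [← Finset.sum_mul, ← Finset.mul_sum]
      have h1 : ∑ j : m, (Matrix.single j j (1 : ℂ) : Matrix m m ℂ) = 1 := by
        ext a b
        simp only [Matrix.sum_apply, Matrix.single_apply, Matrix.one_apply]
        by_cases hab : a = b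
        · subst hab
          simp
        · rw [if_neg hab]
          apply Finset.sum_eq_zero
          intro s _
          rw [if_neg]
          rintro ⟨rfl, rfl⟩
          exact hab rfl
      rw [h1, Matrix.mul_one]
    simp_rw [h]
    exact E.complete

/-- The measurement of an `Outcome` register in its computational basis. -/
def Measurement.readOut : Measurement Outcome where
  M o := Matrix.single o o 1
  complete := by
    ext a b
    simp only [conjTranspose_single, single_mul_single_same, Matrix.sum_apply,
      Matrix.single_apply, Matrix.one_apply, star_one, mul_one]
    by_cases hab : a = b
    · subst hab
      simp
    · rw [if_neg hab]
      apply Finset.sum_eq_zero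
      intro s _
      rw [if_neg]
      rintro ⟨rfl, rfl⟩
      exact hab rfl

end Operations

/-! A round consists of one message of Alice, in a register `X`, followed by one message of Bob,
in a register `Y`; a protocol with `N` rounds has a list of `N` such pairs `(X, Y)`. -/

/-- What Alice does, starting with a memory register `m`: in each round she applies a quantum
operation that prepares her message `X`, and, after having received Bob's message `Y`, another
quantum operation; after the last round she measures her memory and outputs the result. -/
inductive AliceStrategy : List (Reg × Reg) → Reg → Type 1
  | finish {m : Reg} (E : Measurement m) : AliceStrategy [] m
  | round {m m' m'' X Y : Reg} {L : List (Reg × Reg)} (send : Channel m (m' × X))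
      (receive : Channel (m' × Y) m'') (rest : AliceStrategy L m'') :
      AliceStrategy ((X, Y) :: L) m

/-- What Bob does, starting with a memory register `n`: in each round he receives Alice's message
`X` and applies a quantum operation that prepares his message `Y`; after the last round he
measures his memory and outputs the result. -/
inductive BobStrategy : List (Reg × Reg) → Reg → Type 1
  | finish {n : Reg} (E : Measurement n) : BobStrategy [] n
  | round {n n' X Y : Reg} {L : List (Reg × Reg)} (reply : Channel (n × X) (n' × Y))
      (rest : BobStrategy L n') : BobStrategy ((X, Y) :: L) n

/-- A player in the role of Alice: a memory register, its initial state, and a strategy. -/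
structure Alice (L : List (Reg × Reg)) where
  mem : Reg
  init : Density mem
  strategy : AliceStrategy L mem

/-- A player in the role of Bob: a memory register, its initial state, and a strategy. -/
structure Bob (L : List (Reg × Reg)) where
  mem : Reg
  init : Density mem
  strategy : BobStrategy L mem

/-- Hand over the message `x` from the player with memory `p` to the player with memory `q`. -/
def pass {p x q : Type} (ρ : Matrix ((p × x) × q) ((p × x) × q) ℂ) :
    Matrix ((q × x) × p) ((q × x) × p) ℂ :=
  ρ.submatrix (fun i => ((i.2, i.1.2), i.1.1)) (fun i => ((i.2, i.1.2), i.1.1))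

/-- The probability that the players, whose memories are in the joint state `ρ`, output
`cA` and `cB`. -/
def jointProb : {L : List (Reg × Reg)} → {m n : Reg} → AliceStrategy L m → BobStrategy L n →
    Matrix (m × n) (m × n) ℂ → Outcome → Outcome → ℝ
  | [], _, _, .finish E, .finish F, ρ, cA, cB =>
      ((E.M cA ⊗ₖ F.M cB) * ρ * (E.M cA ⊗ₖ F.M cB)ᴴ).trace.re
  | _ :: _, _, _, .round send receive restA, .round reply restB, ρ, cA, cB =>
      jointProb restA restB (receive.apply (pass (reply.apply (pass (send.apply ρ))))) cA cB

/-- The output of the protocol, given the outputs of the two players. -/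
def combine (cA cB : Outcome) : Outcome := if cA = cB then cA else none

/-- The probability that the protocol outputs `c` when `A` and `B` interact. -/
def prob {L : List (Reg × Reg)} (A : Alice L) (B : Bob L) (c : Outcome) : ℝ :=
  ∑ cA : Outcome, ∑ cB : Outcome, if combine cA cB = c then
    jointProb A.strategy B.strategy (A.init.mat ⊗ₖ B.init.mat) cA cB else 0

/-! The numbers `prob A B c` form a probability distribution; in particular they are bounded by
`1`, so that the suprema below are suprema of bounded sets. -/

theorem Channel.apply_posSemidef {m n r : Type} [Fintype m] [DecidableEq m] [Fintype n]
    [Fintype r] [DecidableEq r] (Φ : Channel m n)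
    {ρ : Matrix (m × r) (m × r) ℂ} (h : ρ.PosSemidef) : (Φ.apply ρ).PosSemidef :=
  Matrix.posSemidef_sum _ fun _ _ => h.mul_mul_conjTranspose_same _

theorem Channel.trace_apply {m n r : Type} [Fintype m] [DecidableEq m] [Fintype n]
    [DecidableEq n] [Fintype r] [DecidableEq r] (Φ : Channel m n)
    (ρ : Matrix (m × r) (m × r) ℂ) : (Φ.apply ρ).trace = ρ.trace := by
  have h : ∑ i, (Φ.K i ⊗ₖ (1 : Matrix r r ℂ))ᴴ * (Φ.K i ⊗ₖ (1 : Matrix r r ℂ)) = 1 :=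
    (Φ.tensorId r).complete
  unfold Channel.apply
  rw [trace_sum]
  simp_rw [fun i => trace_mul_comm ((Φ.K i ⊗ₖ (1 : Matrix r r ℂ)) * ρ)
    (Φ.K i ⊗ₖ (1 : Matrix r r ℂ))ᴴ, ← Matrix.mul_assoc]
  rw [← trace_sum, ← Matrix.sum_mul, h, Matrix.one_mul]

theorem trace_pass {p x q : Type} [Fintype p] [Fintype x] [Fintype q]
    (ρ : Matrix ((p × x) × q) ((p × x) × q) ℂ) : (pass ρ).trace = ρ.trace :=
  Fintype.sum_equiv ⟨fun i => ((i.2, i.1.2), i.1.1), fun i => ((i.2, i.1.2), i.1.1),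
    fun _ => rfl, fun _ => rfl⟩ _ _ fun _ => rfl

theorem jointProb_nonneg : ∀ {L : List (Reg × Reg)} {m n : Reg} (A : AliceStrategy L m)
    (B : BobStrategy L n) {ρ : Matrix (m × n) (m × n) ℂ}, ρ.PosSemidef → ∀ cA cB,
    0 ≤ jointProb A B ρ cA cB
  | [], _, _, .finish E, .finish F, ρ, h, cA, cB => by
      rw [jointProb]
      exact (Complex.le_def.1 (h.mul_mul_conjTranspose_same _).trace_nonneg).1
  | _ :: _, _, _, .round _ _ restA, .round _ restB, ρ, h, cA, cB => by
      rw [jointProb]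
      exact jointProb_nonneg restA restB (Channel.apply_posSemidef _
        ((Channel.apply_posSemidef _ ((Channel.apply_posSemidef _ h).submatrix _)).submatrix _)) _ _

theorem sum_jointProb : ∀ {L : List (Reg × Reg)} {m n : Reg} (A : AliceStrategy L m)
    (B : BobStrategy L n) (ρ : Matrix (m × n) (m × n) ℂ),
    ∑ cA, ∑ cB, jointProb A B ρ cA cB = ρ.trace.re
  | [], _, _, .finish E, .finish F, ρ => by
      simp_rw [jointProb, ← Complex.re_sum, fun cA cB => trace_mul_comm
        ((E.M cA ⊗ₖ F.M cB) * ρ) (E.M cA ⊗ₖ F.M cB)ᴴ, ← Matrix.mul_assoc, ← trace_sum,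
        ← Matrix.sum_mul, conjTranspose_kronecker, ← mul_kronecker_mul]
      have h : ∑ cA, ∑ cB, ((E.M cA)ᴴ * E.M cA) ⊗ₖ ((F.M cB)ᴴ * F.M cB)
          = (∑ cA, (E.M cA)ᴴ * E.M cA) ⊗ₖ (∑ cB, (F.M cB)ᴴ * F.M cB) := by
        ext ⟨a, b⟩ ⟨c, d⟩
        simp only [Matrix.sum_apply, kroneckerMap_apply, Finset.sum_mul_sum]
      rw [h, E.complete, F.complete, one_kronecker_one, Matrix.one_mul]
  | _ :: _, _, _, .round _ _ restA, .round _ restB, ρ => by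
      simp_rw [jointProb]
      rw [sum_jointProb restA restB, Channel.trace_apply, trace_pass, Channel.trace_apply,
        trace_pass, Channel.trace_apply]

theorem prob_nonneg {L : List (Reg × Reg)} (A : Alice L) (B : Bob L) (c : Outcome) :
    0 ≤ prob A B c := by
  refine Finset.sum_nonneg fun cA _ => Finset.sum_nonneg fun cB _ => ?_
  split_ifs
  · exact jointProb_nonneg _ _ (A.init.pos.kronecker B.init.pos) _ _
  · exact le_rfl

theorem sum_prob {L : List (Reg × Reg)} (A : Alice L) (B : Bob L) :
    ∑ c : Outcome, prob A B c = 1 := by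
  unfold prob
  rw [Finset.sum_comm]
  simp_rw [fun cA => Finset.sum_comm (s := (Finset.univ : Finset Outcome)) (t := Finset.univ)
    (f := fun c cB => if combine cA cB = c then
      jointProb A.strategy B.strategy (A.init.mat ⊗ₖ B.init.mat) cA cB else 0)]
  simp only [Finset.sum_ite_eq, Finset.mem_univ, if_true]
  rw [sum_jointProb, trace_kronecker, A.init.trace_eq_one, B.init.trace_eq_one]
  simp

theorem prob_le_one {L : List (Reg × Reg)} (A : Alice L) (B : Bob L) (c : Outcome) :
    prob A B c ≤ 1 :=
  (Finset.single_le_sum (fun c _ => prob_nonneg A B c) (Finset.mem_univ c)).trans_eq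
    (sum_prob A B)

/-- A quantum coin flipping protocol: its rounds and its two honest players. -/
structure Protocol where
  rounds : List (Reg × Reg)
  alice : Alice rounds
  bob : Bob rounds

namespace Protocol

/-- The number of rounds of communication. -/
def numRounds (P : Protocol) : ℕ := P.rounds.length

/-- Weak coin flipping: the supremum, over all strategies of a cheating Alice, of the probability
that Alice wins against the honest Bob. -/
def weakCheatA (P : Protocol) : ℝ := ⨆ A : Alice P.rounds, prob A P.bob (some 0)

/-- Weak coin flipping: the supremum, over all strategies of a cheating Bob, of the probability
that Bob wins against the honest Alice. -/
def weakCheatB (P : Protocol) : ℝ := ⨆ B : Bob P.rounds, prob P.alice B (some 1)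

/-- `P` is a weak coin flipping protocol with parameter `z` and bias `ε`. -/
structure IsWCF (P : Protocol) (z ε : ℝ) : Prop where
  honest_alice_wins : prob P.alice P.bob (some 0) = z
  honest_bob_wins : prob P.alice P.bob (some 1) = 1 - z
  cheatA_le : P.weakCheatA ≤ z + ε
  cheatB_le : P.weakCheatB ≤ (1 - z) + ε

/-- Strong coin flipping: the cheating probability of Alice. -/
def strongCheatA (P : Protocol) : ℝ :=
  ⨆ A : Alice P.rounds, max (prob A P.bob (some 0)) (prob A P.bob (some 1))

/-- Strong coin flipping: the cheating probability of Bob. -/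
def strongCheatB (P : Protocol) : ℝ :=
  ⨆ B : Bob P.rounds, max (prob P.alice B (some 0)) (prob P.alice B (some 1))

/-- `P` is a strong coin flipping protocol with bias `ε`. -/
structure IsSCF (P : Protocol) (ε : ℝ) : Prop where
  honest_zero : prob P.alice P.bob (some 0) = 1 / 2
  honest_one : prob P.alice P.bob (some 1) = 1 / 2
  cheatA_le : P.strongCheatA ≤ 1 / 2 + ε
  cheatB_le : P.strongCheatB ≤ 1 / 2 + ε

end Protocol

/-! The strong coin flipping protocol built on a weak coin flipping protocol. The honest players
keep the bit `a` in a second memory register while they run the weak coin flipping protocol. -/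

/-- A register holding one bit. -/
abbrev bitReg : Reg := Reg.of (Fin 2)

/-- The register of an empty message. -/
abbrev emptyReg : Reg := Reg.of Unit

/-- Exchange the last two factors. -/
def swapRight (α β γ : Type) : (α × β) × γ ≃ (α × γ) × β where
  toFun i := ((i.1.1, i.2), i.1.2)
  invFun i := ((i.1.1, i.2), i.1.2)
  left_inv _ := rfl
  right_inv _ := rfl

/-- What an honest Alice outputs, given the outcome `o` of the weak coin flip for her, the bit `a`
that she announced, and the bit `b` that she received from Bob. -/
def aliceOutput (i : (Outcome × Fin 2) × Fin 2) : Outcome :=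
  if i.1.1 = some 0 then some i.1.2 else if i.1.1 = some 1 then some i.2 else none

/-- The probability that an honest Bob outputs `t.1` and sends the bit `t.2`, given the outcome
`i.1` of the weak coin flip for him and the bit `a = i.2` announced by Alice. If he won, he picks
`b` with `b = a` with probability `p`, sends it and outputs it; otherwise the bit that he sends
carries no information. -/
def bobWeight (p : unitInterval) (i t : Outcome × Fin 2) : ℝ :=
  if i.1 = some 1 then
    if t.1 = some t.2 then (if t.2 = i.2 then (p : ℝ) else 1 - (p : ℝ)) else 0
  else
    if t = (if i.1 = some 0 then some i.2 else none, 0) then 1 else 0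

theorem bobWeight_nonneg (p : unitInterval) (i t : Outcome × Fin 2) : 0 ≤ bobWeight p i t := by
  have h0 : (0 : ℝ) ≤ p := p.2.1
  have h1 : (0 : ℝ) ≤ 1 - p := sub_nonneg.2 p.2.2
  unfold bobWeight
  split_ifs <;> first | assumption | norm_num

theorem bobWeight_sum (p : unitInterval) (i : Outcome × Fin 2) :
    ∑ t, bobWeight p i t = 1 := by
  obtain ⟨o, a⟩ := i
  unfold bobWeight
  by_cases ho : o = some 1
  · subst ho
    rw [Fintype.sum_prod_type, Fintype.sum_option]
    fin_cases a <;> simp [Fin.sum_univ_two]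
  · simp [ho]

/-- The last round and the output of the honest Alice: she records the result of the weak coin
flip, sends an empty message, and receives the bit `b`. -/
def aliceLast {m : Reg} (E : Measurement m) :
    AliceStrategy [(emptyReg, bitReg)] (Reg.of (m × Fin 2)) :=
  .round (m' := Reg.of (Outcome × Fin 2)) (m'' := Reg.of Outcome)
    ((E.record.tensorId (Fin 2)).reindex (Equiv.refl _) (Equiv.prodPUnit _))
    (Channel.function aliceOutput)
    (.finish Measurement.readOut)

/-- The last round and the output of the honest Bob: he records the result of the weak coin flip,
receives an empty message, decides, and sends the bit `b`. -/
def bobLast (p : unitInterval) {n : Reg} (E : Measurement n) :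
    BobStrategy [(emptyReg, bitReg)] (Reg.of (n × Fin 2)) :=
  .round (n' := Reg.of Outcome)
    (((E.record.tensorId (Fin 2)).reindex (Equiv.prodPUnit _) (Equiv.refl _)).andThen
      (Channel.classical (bobWeight p) (bobWeight_nonneg p) (bobWeight_sum p)))
    (.finish Measurement.readOut)

/-- Follow a strategy while keeping the bit `a`, and then play the last round. -/
def AliceStrategy.extend : {L : List (Reg × Reg)} → {m : Reg} → AliceStrategy L m →
    AliceStrategy (L ++ [(emptyReg, bitReg)]) (Reg.of (m × Fin 2))
  | [], _, .finish E => aliceLast E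
  | _ :: _, _, .round (m' := m') (m'' := m'') send receive rest =>
      .round (m' := Reg.of (m' × Fin 2)) (m'' := Reg.of (m'' × Fin 2))
        ((send.tensorId (Fin 2)).reindex (Equiv.refl _) (swapRight _ _ _))
        ((receive.tensorId (Fin 2)).reindex (swapRight _ _ _) (Equiv.refl _))
        rest.extend

/-- Follow a strategy while keeping the bit `a`, and then play the last round. -/
def BobStrategy.extend (p : unitInterval) : {L : List (Reg × Reg)} → {n : Reg} →
    BobStrategy L n → BobStrategy (L ++ [(emptyReg, bitReg)]) (Reg.of (n × Fin 2))
  | [], _, .finish E => bobLast p E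
  | _ :: _, _, .round (n' := n') reply rest =>
      .round (n' := Reg.of (n' × Fin 2))
        ((reply.tensorId (Fin 2)).reindex (swapRight _ _ _) (swapRight _ _ _))
        (rest.extend p)

/-- The state of a register `m` in the given state together with a uniformly random bit. -/
def Density.withRandomBit {m : Reg} (ρ : Density m) : Density (Reg.of (m × Fin 2)) where
  mat := ρ.mat ⊗ₖ ((1 / 2 : ℂ) • (1 : Matrix (Fin 2) (Fin 2) ℂ))
  pos := by
    refine ρ.pos.kronecker (Matrix.PosSemidef.one.smul ?_)
    norm_num [Complex.le_def]
  trace_eq_one := by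
    rw [trace_kronecker, ρ.trace_eq_one]
    simp [Matrix.trace_smul]

/-- Honest Alice: she chooses a uniformly random bit `a`, sends a copy of it to Bob, and receives
an empty message; then she plays the weak coin flipping protocol and the last round. -/
def strongAlice {L : List (Reg × Reg)} (A : Alice L) :
    Alice ((bitReg, emptyReg) :: (L ++ [(emptyReg, bitReg)])) where
  mem := Reg.of (A.mem × Fin 2)
  init := A.init.withRandomBit
  strategy :=
    .round (m' := Reg.of (A.mem × Fin 2)) (m'' := Reg.of (A.mem × Fin 2))
      (((Channel.function (fun a : Fin 2 => (a, a))).tensorId A.mem).reindex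
        (Equiv.prodComm _ _) ((Equiv.prodAssoc _ _ _).trans (Equiv.prodComm _ _)))
      ((Channel.id (A.mem × Fin 2)).reindex (Equiv.prodPUnit _) (Equiv.refl _))
      A.strategy.extend

/-- Honest Bob: he reads the bit `a` announced by Alice and answers with an empty message; then he
plays the weak coin flipping protocol and the last round. -/
def strongBob (p : unitInterval) {L : List (Reg × Reg)} (B : Bob L) :
    Bob ((bitReg, emptyReg) :: (L ++ [(emptyReg, bitReg)])) where
  mem := B.mem
  init := B.init
  strategy :=
    .round (n' := Reg.of (B.mem × Fin 2))
      (((Channel.function (fun a : Fin 2 => a)).tensorId B.mem).reindex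
        (Equiv.prodComm _ _) ((Equiv.prodPUnit _).trans (Equiv.prodComm _ _)))
      (B.strategy.extend p)

/-- The strong coin flipping protocol with parameter `p` that uses `Q` as a subroutine. -/
def Protocol.strong (Q : Protocol) (p : unitInterval) : Protocol where
  rounds := (bitReg, emptyReg) :: (Q.rounds ++ [(emptyReg, bitReg)])
  alice := strongAlice Q.alice
  bob := strongBob p Q.bob

end CoinFlip

end

/-! Write `w = z + ε` and `v = 1 - z + ε` for the bounds on the cheating probabilities of `Q`.
Cheating Alice: condition on the announced bit `a`, and let `q0`, `q1` be the probabilities of Bob's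
results in `Q`. Bob outputs `a` with probability `q0 + p * q1` and the other bit with probability
`(1 - p) * q1`. Since `q0 ≤ w` and `q0 + q1 ≤ 1`, these are at most `p + (1 - p) * w` and `1 - p`;
the chosen `p` makes both equal to `1 / (2 - w)` when `w ≤ 1`, and for `w ≥ 1` the claimed bound is
at least `1`. Cheating Bob: his target `c` equals `a` with probability `1 / 2`. Otherwise honest
Alice outputs `c` only if her result in `Q` is that Bob won, which has probability at most `v`. The
total is `(1 + v) / 2`. Honest players: the results of `Q` agree and are never Abort, so averaging
over `a` gives `1 / 2` for each bit, whatever `p` is.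

The work lies in reducing `S` to `Q`. The announcement is classical, so the state after the first
round is a mixture over `a` of product states (`jointProb_strongAlice`, `jointProb_strongBob`).
During `Q` the stored bit is a spectator on which every honest operation acts as the identity, so
induction on the rounds moves it past them. A cheater's strategy cut off before the last round and
completed by a constant winning output is a strategy against `Q` (`sum_jointProb_bob_extend`,
`sum_jointProb_alice_extend_le`). The constant output makes the agreement demanded by `prob`
automatic, so only the honest result counts. -/

namespace CoinFlip

set_option linter.unusedSectionVars false

/-! ### Spectator registers and the action of channels on diagonal blocks -/

section States

variable {m n k r S : Type} [Fintype m] [DecidableEq m] [Fintype n] [DecidableEq n]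
  [Fintype k] [DecidableEq k] [Fintype r] [DecidableEq r] [Fintype S] [DecidableEq S]

/-- The state `ρ ⊗ σ`, where the basis is relabelled along `e`. -/
def withSide {α' α : Type} (e : α' ≃ α × S) (σ : Matrix S S ℂ) (ρ : Matrix α α ℂ) :
    Matrix α' α' ℂ :=
  (ρ ⊗ₖ σ).submatrix e e

/-- This is the mixed-product rule `(K ⊗ 1)(ρ ⊗ σ)(K ⊗ 1)ᴴ = KρKᴴ ⊗ σ`. The equivalences `e` and `f`
absorb the position of the side register, so each use only requires an entrywise check of the Kraus
operators. -/
theorem sum_kraus_withSide {ι α β α' β' : Type} [Fintype ι] [Fintype α] [Fintype α']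
    (K : ι → Matrix β α ℂ) (K' : ι → Matrix β' α' ℂ) (e : α' ≃ α × S) (f : β' ≃ β × S)
    (h : ∀ i, K' i = (K i ⊗ₖ (1 : Matrix S S ℂ)).submatrix f e)
    (σ : Matrix S S ℂ) (ρ : Matrix α α ℂ) :
    ∑ i, K' i * withSide e σ ρ * (K' i)ᴴ = withSide f σ (∑ i, K i * ρ * (K i)ᴴ) := by
  have hi : ∀ i, K' i * withSide e σ ρ * (K' i)ᴴ
      = withSide f σ (K i * ρ * (K i)ᴴ) := by
    intro i
    rw [h, withSide, withSide, conjTranspose_submatrix, submatrix_mul_equiv, submatrix_mul_equiv,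
      conjTranspose_kronecker, ← mul_kronecker_mul, ← mul_kronecker_mul]
    simp
  simp_rw [hi]
  ext x y
  simp [withSide, Matrix.sum_apply, kroneckerMap_apply, Finset.sum_mul]

/-- Move the middle register to the end. -/
def moveMid (α β γ δ : Type) : ((α × β) × γ) × δ ≃ ((α × γ) × δ) × β where
  toFun i := (((i.1.1.1, i.1.2), i.2), i.1.1.2)
  invFun i := (((i.1.1.1, i.2), i.1.1.2), i.1.2)
  left_inv _ := rfl
  right_inv _ := rfl

/-- An operation on the first register commutes with a side register at the end. -/
theorem Channel.apply_withSide (Φ : Channel m n) (σ : Matrix S S ℂ)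
    (ρ : Matrix (m × r) (m × r) ℂ) :
    Φ.apply (withSide (Equiv.prodAssoc m r S).symm σ ρ)
      = withSide (Equiv.prodAssoc n r S).symm σ (Φ.apply ρ) := by
  refine sum_kraus_withSide (fun i => Φ.K i ⊗ₖ (1 : Matrix r r ℂ)) _ _ _ (fun i => ?_) σ ρ
  ext ⟨a, b, c⟩ ⟨a', b', c'⟩
  simp [kroneckerMap_apply, Matrix.one_apply, ite_and]
  split_ifs <;> simp

/-- A player who stores a bit has it between memory and message, which is the layout `moveMid`. This
lemma and the next two cover sending, receiving and replying in an extended strategy. -/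
theorem Channel.apply_withSide_send {x : Type} [Fintype x] [DecidableEq x]
    (Φ : Channel m (n × x)) (σ : Matrix S S ℂ) (ρ : Matrix (m × r) (m × r) ℂ) :
    ((Φ.tensorId S).reindex (Equiv.refl _) (swapRight n S x)).apply
        (withSide (swapRight m S r) σ ρ) = withSide (moveMid n S x r) σ (Φ.apply ρ) := by
  refine sum_kraus_withSide (fun i => Φ.K i ⊗ₖ (1 : Matrix r r ℂ)) _ _ _ (fun i => ?_) σ ρ
  ext ⟨⟨⟨a, b⟩, c⟩, d⟩ ⟨⟨a', b'⟩, c'⟩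
  simp [kroneckerMap_apply, Matrix.one_apply, Channel.tensorId, Channel.reindex, swapRight,
    moveMid]
  split_ifs <;> rfl

theorem Channel.apply_withSide_receive {x : Type} [Fintype x] [DecidableEq x]
    (Φ : Channel (m × x) n) (σ : Matrix S S ℂ)
    (ρ : Matrix ((m × x) × r) ((m × x) × r) ℂ) :
    ((Φ.tensorId S).reindex (swapRight m S x) (Equiv.refl _)).apply
        (withSide (moveMid m S x r) σ ρ) = withSide (swapRight n S r) σ (Φ.apply ρ) := by
  refine sum_kraus_withSide (fun i => Φ.K i ⊗ₖ (1 : Matrix r r ℂ)) _ _ _ (fun i => ?_) σ ρ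
  ext ⟨⟨a, b⟩, c⟩ ⟨⟨⟨a', b'⟩, c'⟩, d'⟩
  simp [kroneckerMap_apply, Matrix.one_apply, Channel.tensorId, Channel.reindex, swapRight,
    moveMid]
  split_ifs <;> rfl

theorem Channel.apply_withSide_reply {x y : Type} [Fintype x] [DecidableEq x] [Fintype y]
    [DecidableEq y] (Φ : Channel (m × x) (n × y)) (σ : Matrix S S ℂ)
    (ρ : Matrix ((m × x) × r) ((m × x) × r) ℂ) :
    ((Φ.tensorId S).reindex (swapRight m S x) (swapRight n S y)).apply
        (withSide (moveMid m S x r) σ ρ) = withSide (moveMid n S y r) σ (Φ.apply ρ) := by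
  refine sum_kraus_withSide (fun i => Φ.K i ⊗ₖ (1 : Matrix r r ℂ)) _ _ _ (fun i => ?_) σ ρ
  ext ⟨⟨⟨a, b⟩, c⟩, d⟩ ⟨⟨⟨a', b'⟩, c'⟩, d'⟩
  simp [kroneckerMap_apply, Matrix.one_apply, Channel.tensorId, Channel.reindex, swapRight,
    moveMid]
  split_ifs <;> rfl

/-- Handing over a message exchanges the active and the passive player, so a bit stored by the
passive one (layout `prodAssoc`) becomes a bit stored by the active one (layout `moveMid`). The next
lemma is the converse. -/
theorem pass_withSide_assoc {p x q : Type} (σ : Matrix S S ℂ)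
    (ρ : Matrix ((p × x) × q) ((p × x) × q) ℂ) :
    pass (withSide (Equiv.prodAssoc (p × x) q S).symm σ ρ)
      = withSide (moveMid q S x p) σ (pass ρ) := rfl

theorem pass_withSide_moveMid {p x q : Type} (σ : Matrix S S ℂ)
    (ρ : Matrix ((p × x) × q) ((p × x) × q) ℂ) :
    pass (withSide (moveMid p S x q) σ ρ)
      = withSide (Equiv.prodAssoc (q × x) p S).symm σ (pass ρ) := rfl

/-- Recording a measurement result next to a bit, with an empty message at the output. -/
theorem Measurement.record_apply_withSide_send (E : Measurement m) (σ : Matrix S S ℂ)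
    (ρ : Matrix (m × r) (m × r) ℂ) :
    ((E.record.tensorId S).reindex (Equiv.refl _) (Equiv.prodPUnit _)).apply
        (withSide (swapRight m S r) σ ρ)
      = withSide (moveMid Outcome S Unit r) σ
          ((E.record.apply ρ).submatrix (fun i => (i.1.1, i.2)) (fun i => (i.1.1, i.2))) := by
  refine sum_kraus_withSide (fun i => E.record.K i ⊗ₖ (1 : Matrix r r ℂ)) _ _
    (((Equiv.prodPUnit _).prodCongr (Equiv.refl _)).trans (swapRight Outcome S r))
    (fun i => ?_) σ ρ
  ext ⟨⟨⟨a, b⟩, c⟩, d⟩ ⟨⟨a', b'⟩, c'⟩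
  simp [kroneckerMap_apply, Matrix.one_apply, Channel.tensorId, Channel.reindex, swapRight]
  split_ifs <;> rfl

/-- Recording a measurement result next to a bit, with an empty message at the input. -/
theorem Measurement.record_apply_withSide_receive (E : Measurement m) (σ : Matrix S S ℂ)
    (ρ : Matrix ((m × Unit) × r) ((m × Unit) × r) ℂ) :
    ((E.record.tensorId S).reindex (Equiv.prodPUnit _) (Equiv.refl _)).apply
        (withSide (moveMid m S Unit r) σ ρ)
      = withSide (swapRight Outcome S r) σ (E.record.apply
          (ρ.submatrix (fun i => ((i.1, ()), i.2)) (fun i => ((i.1, ()), i.2)))) := by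
  have h : withSide (moveMid m S Unit r) σ ρ = withSide (((Equiv.prodPUnit _).prodCongr
      (Equiv.refl _)).trans (swapRight m S r)) σ
      (ρ.submatrix (fun i => ((i.1, ()), i.2)) (fun i => ((i.1, ()), i.2))) := rfl
  rw [h]
  refine sum_kraus_withSide (fun i => E.record.K i ⊗ₖ (1 : Matrix r r ℂ)) _ _ _
    (fun i => ?_) σ _
  ext ⟨⟨a, b⟩, c⟩ ⟨⟨⟨a', b'⟩, c'⟩, d'⟩
  simp [kroneckerMap_apply, Matrix.one_apply, Channel.tensorId, Channel.reindex, swapRight]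
  split_ifs <;> rfl

theorem Channel.andThen_apply (Φ : Channel m n) (Ψ : Channel n k)
    (ρ : Matrix (m × r) (m × r) ℂ) :
    (Φ.andThen Ψ).apply ρ = Ψ.apply (Φ.apply ρ) := by
  change ∑ i : Φ.ι × Ψ.ι, ((Ψ.K i.2 * Φ.K i.1) ⊗ₖ (1 : Matrix r r ℂ)) * ρ
    * ((Ψ.K i.2 * Φ.K i.1) ⊗ₖ (1 : Matrix r r ℂ))ᴴ = _
  simp only [Channel.apply]
  rw [Fintype.sum_prod_type, Finset.sum_comm]
  refine Finset.sum_congr rfl fun j _ => ?_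
  rw [Matrix.mul_sum, Matrix.sum_mul]
  refine Finset.sum_congr rfl fun i _ => ?_
  have h : (Ψ.K j * Φ.K i) ⊗ₖ (1 : Matrix r r ℂ) 
      = (Ψ.K j ⊗ₖ (1 : Matrix r r ℂ)) * (Φ.K i ⊗ₖ (1 : Matrix r r ℂ)) := by
    rw [← mul_kronecker_mul, Matrix.one_mul]
  change ((Ψ.K j * Φ.K i) ⊗ₖ (1 : Matrix r r ℂ)) * ρ
    * ((Ψ.K j * Φ.K i) ⊗ₖ (1 : Matrix r r ℂ))ᴴ = _
  rw [h, conjTranspose_mul]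
  simp only [Matrix.mul_assoc]

theorem kronecker_one_mul_mul_apply (M : Matrix n m ℂ) (ρ : Matrix (m × r) (m × r) ℂ)
    (x y : n × r) :
    ((M ⊗ₖ (1 : Matrix r r ℂ)) * ρ * (M ⊗ₖ (1 : Matrix r r ℂ))ᴴ) x y
      = ∑ i, ∑ j, M x.1 i * ρ (i, x.2) (j, y.2) * star (M y.1 j) := by
  simp only [Matrix.mul_apply, kroneckerMap_apply, Fintype.sum_prod_type, Matrix.one_apply,
    conjTranspose_apply, mul_ite, mul_one, mul_zero, ite_mul, zero_mul, Finset.sum_ite_eq,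
    Finset.mem_univ, if_true, apply_ite star, star_zero, Finset.sum_mul]
  rw [Finset.sum_comm]

theorem Channel.apply_apply (Φ : Channel m n) (ρ : Matrix (m × r) (m × r) ℂ) (x y : n × r) :
    Φ.apply ρ x y = ∑ k, ∑ i, ∑ j, Φ.K k x.1 i * ρ (i, x.2) (j, y.2) * star (Φ.K k y.1 j) := by
  simp only [Channel.apply, Matrix.sum_apply, kronecker_one_mul_mul_apply]

/-- Classical processing acts on the diagonal like the corresponding stochastic matrix. -/
theorem Channel.classical_apply (w : m → n → ℝ) (h0 h1) (ρ : Matrix (m × r) (m × r) ℂ)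
    (t : n) (x y : r) :
    (Channel.classical w h0 h1).apply ρ (t, x) (t, y) = ∑ s, (w s t : ℂ) * ρ (s, x) (s, y) := by
  rw [Channel.apply_apply]
  change ∑ k : m × n, ∑ i, ∑ j, Matrix.single k.2 k.1 ((Real.sqrt (w k.1 k.2) : ℝ) : ℂ) t i
    * ρ (i, x) (j, y) * star (Matrix.single k.2 k.1 ((Real.sqrt (w k.1 k.2) : ℝ) : ℂ) t j) = _
  rw [Fintype.sum_prod_type]
  refine Finset.sum_congr rfl fun s _ => ?_
  -- Only the Kraus operator from `s` to `t` has a nonzero row `t`, supported in column `s`; its two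
  -- square roots multiply to `w s t`.
  rw [Finset.sum_eq_single t, Finset.sum_eq_single s, Finset.sum_eq_single s]
  · simp only [Matrix.single_apply_same, Complex.star_def, Complex.conj_ofReal]
    rw [mul_right_comm, ← Complex.ofReal_mul, Real.mul_self_sqrt (h0 _ _)]
  · intro j _ hj
    simp [hj.symm]
  · simp
  · intro j _ hj
    simp [Matrix.single_apply, hj.symm]
  · simp
  · intro j _ hj
    simp [hj]
  · simp

theorem Channel.function_apply (f : m → n) (ρ : Matrix (m × r) (m × r) ℂ) (t : n) (x y : r) :
    (Channel.function f).apply ρ (t, x) (t, y) = ∑ s, if t = f s then ρ (s, x) (s, y) else 0 := by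
  rw [Channel.function, Channel.classical_apply]
  refine Finset.sum_congr rfl fun s _ => ?_
  split_ifs <;> simp

/-- An operation on the first register does not change the state of the second one. -/
theorem Channel.sum_apply_fst (Φ : Channel m n) (ρ : Matrix (m × r) (m × r) ℂ) (x y : r) :
    ∑ t, Φ.apply ρ (t, x) (t, y) = ∑ s, ρ (s, x) (s, y) := by
  -- Trace preservation `∑ Kᴴ K = 1` read entrywise: this sum appears when the first factor is
  -- traced out.
  have hc : ∀ i j, ∑ k, ∑ t, star (Φ.K k t j) * Φ.K k t i = if j = i then 1 else 0 := by
    intro i j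
    have := congrFun (congrFun Φ.complete j) i
    simpa [Matrix.sum_apply, Matrix.mul_apply, Matrix.one_apply] using this
  simp_rw [Channel.apply_apply]
  calc _ = ∑ i, ∑ j, (∑ k, ∑ t, star (Φ.K k t j) * Φ.K k t i) * ρ (i, x) (j, y) := by
        rw [Finset.sum_comm]
        simp_rw [fun k => Finset.sum_comm (s := (Finset.univ : Finset n)) (t := Finset.univ)
          (f := fun t i => ∑ j, Φ.K k t i * ρ (i, x) (j, y) * star (Φ.K k t j)),
          fun k i => Finset.sum_comm (s := (Finset.univ : Finset n)) (t := Finset.univ)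
          (f := fun t j => Φ.K k t i * ρ (i, x) (j, y) * star (Φ.K k t j))]
        rw [Finset.sum_comm]
        refine Finset.sum_congr rfl fun i _ => ?_
        rw [Finset.sum_comm]
        refine Finset.sum_congr rfl fun j _ => ?_
        simp_rw [Finset.sum_mul]
        refine Finset.sum_congr rfl fun k _ => Finset.sum_congr rfl fun t _ => ?_
        ring
    _ = _ := by
        simp_rw [hc]
        simp

/-- The diagonal blocks after a measurement has been recorded. -/
theorem Measurement.record_apply (E : Measurement m) (ρ : Matrix (m × r) (m × r) ℂ)
    (o : Outcome) (x y : r) :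
    E.record.apply ρ (o, x) (o, y)
      = ∑ j, ((E.M o ⊗ₖ (1 : Matrix r r ℂ)) * ρ * (E.M o ⊗ₖ (1 : Matrix r r ℂ))ᴴ)
          (j, x) (j, y) := by
  rw [Channel.apply_apply]
  simp only [kronecker_one_mul_mul_apply]
  change ∑ k : Outcome × m, ∑ i, ∑ j, (Matrix.single k.1 k.2 (1 : ℂ) * E.M k.1) o i
    * ρ (i, x) (j, y) * star ((Matrix.single k.1 k.2 (1 : ℂ) * E.M k.1) o j) = _
  rw [Fintype.sum_prod_type, Finset.sum_eq_single o]
  · simp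
  · intro o' _ ho'
    simp [Matrix.single_mul_apply_of_ne, ho'.symm]
  · simp

end States

/-! ### Outcome statistics of product measurements -/

section States

variable {m n k r S : Type} [Fintype m] [DecidableEq m] [Fintype n] [DecidableEq n]
  [Fintype k] [DecidableEq k] [Fintype r] [DecidableEq r] [Fintype S] [DecidableEq S]

theorem withSide_posSemidef {α' α : Type} [Fintype α] [Fintype α'] (e : α' ≃ α × S)
    {σ : Matrix S S ℂ} {ρ : Matrix α α ℂ} (hσ : σ.PosSemidef) (hρ : ρ.PosSemidef) :
    (withSide e σ ρ).PosSemidef :=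
  (hρ.kronecker hσ).submatrix e

theorem pass_posSemidef {p x q : Type} [Fintype p] [Fintype x] [Fintype q]
    {ρ : Matrix ((p × x) × q) ((p × x) × q) ℂ} (hρ : ρ.PosSemidef) : (pass ρ).PosSemidef :=
  hρ.submatrix _

theorem one_kronecker_mul_mul_apply (M : Matrix n r ℂ) (ρ : Matrix (m × r) (m × r) ℂ)
    (x y : m × n) :
    (((1 : Matrix m m ℂ) ⊗ₖ M) * ρ * ((1 : Matrix m m ℂ) ⊗ₖ M)ᴴ) x y
      = ∑ i, ∑ j, M x.2 i * ρ (x.1, i) (y.1, j) * star (M y.2 j) := by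
  simp only [Matrix.mul_apply, kroneckerMap_apply, Fintype.sum_prod_type, Matrix.one_apply,
    conjTranspose_apply, one_mul, mul_ite, mul_zero, ite_mul, zero_mul,
    apply_ite star, star_zero, Finset.sum_mul]
  simp
  rw [Finset.sum_comm]

/-- The outcome probability for a product measurement, written with a recorded outcome for the
first factor. -/
theorem trace_kronecker_eq_sum_record (E : Measurement m) (o : Outcome) (M : Matrix n n ℂ)
    (ρ : Matrix (m × n) (m × n) ℂ) :
    ((E.M o ⊗ₖ M) * ρ * (E.M o ⊗ₖ M)ᴴ).trace
      = ∑ j, ∑ k, ∑ l, M j k * E.record.apply ρ (o, k) (o, l) * star (M j l) := by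
  have h : E.M o ⊗ₖ M = ((1 : Matrix m m ℂ) ⊗ₖ M) * (E.M o ⊗ₖ (1 : Matrix n n ℂ)) := by
    rw [← mul_kronecker_mul, Matrix.one_mul, Matrix.mul_one]
  have h2 : (E.M o ⊗ₖ M) * ρ * (E.M o ⊗ₖ M)ᴴ = ((1 : Matrix m m ℂ) ⊗ₖ M)
      * ((E.M o ⊗ₖ (1 : Matrix n n ℂ)) * ρ * (E.M o ⊗ₖ (1 : Matrix n n ℂ))ᴴ)
      * ((1 : Matrix m m ℂ) ⊗ₖ M)ᴴ := by
    rw [h, conjTranspose_mul]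
    simp only [Matrix.mul_assoc]
  rw [h2, Matrix.trace, Fintype.sum_prod_type, Finset.sum_comm]
  refine Finset.sum_congr rfl fun j _ => ?_
  simp only [Matrix.diag_apply, one_kronecker_mul_mul_apply]
  rw [Finset.sum_comm]
  refine Finset.sum_congr rfl fun k _ => ?_
  rw [Finset.sum_comm]
  refine Finset.sum_congr rfl fun l _ => ?_
  rw [Measurement.record_apply, Finset.mul_sum, Finset.sum_mul]

/-- The measurement with a fixed result. -/
def Measurement.const (m : Type) [Fintype m] [DecidableEq m] (o : Outcome) : Measurement m where
  M o' := if o' = o then 1 else 0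
  complete := by
    rw [Finset.sum_eq_single o]
    · simp
    · intro b _ hb
      simp [hb]
    · simp

/-- Only the partial trace over the first factor enters. Together with `Channel.sum_apply_fst` this
gives no-signalling. -/
theorem trace_one_kronecker (M : Matrix n n ℂ) (ρ : Matrix (m × n) (m × n) ℂ) :
    (((1 : Matrix m m ℂ) ⊗ₖ M) * ρ * ((1 : Matrix m m ℂ) ⊗ₖ M)ᴴ).trace
      = ∑ j, ∑ k, ∑ l, M j k * (∑ i, ρ (i, k) (i, l)) * star (M j l) := by
  rw [Matrix.trace, Fintype.sum_prod_type, Finset.sum_comm]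
  refine Finset.sum_congr rfl fun j _ => ?_
  simp only [Matrix.diag_apply, one_kronecker_mul_mul_apply]
  rw [Finset.sum_comm]
  refine Finset.sum_congr rfl fun k _ => ?_
  rw [Finset.sum_comm]
  refine Finset.sum_congr rfl fun l _ => ?_
  rw [Finset.mul_sum, Finset.sum_mul]

theorem sum_record_apply (E : Measurement m) (o : Outcome) (ρ : Matrix (m × n) (m × n) ℂ) :
    ∑ j, E.record.apply ρ (o, j) (o, j)
      = ((E.M o ⊗ₖ (1 : Matrix n n ℂ)) * ρ * (E.M o ⊗ₖ (1 : Matrix n n ℂ))ᴴ).trace := by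
  rw [trace_kronecker_eq_sum_record]
  refine Finset.sum_congr rfl fun j _ => ?_
  simp [Matrix.one_apply]

/-- Recording a result for the second factor. -/
theorem sum_record_apply_swap (F : Measurement n) (o : Outcome) (ρ : Matrix (m × n) (m × n) ℂ)
    (ν : Matrix (n × k) (n × k) ℂ) (h : ∀ x y, ∑ i, ν (x, i) (y, i) = ∑ i, ρ (i, x) (i, y)) :
    ∑ i, F.record.apply ν (o, i) (o, i)
      = (((1 : Matrix m m ℂ) ⊗ₖ F.M o) * ρ * ((1 : Matrix m m ℂ) ⊗ₖ F.M o)ᴴ).trace := by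
  rw [trace_one_kronecker]
  simp_rw [Measurement.record_apply, kronecker_one_mul_mul_apply, ← h]
  rw [Finset.sum_comm]
  refine Finset.sum_congr rfl fun j _ => ?_
  rw [Finset.sum_comm]
  refine Finset.sum_congr rfl fun k _ => ?_
  rw [Finset.sum_comm]
  refine Finset.sum_congr rfl fun l _ => ?_
  rw [Finset.mul_sum, Finset.sum_mul]

/-- Reading out two outcome registers. -/
theorem trace_readOut (ρ : Matrix (Outcome × Outcome) (Outcome × Outcome) ℂ) (cA cB : Outcome) :
    ((Measurement.readOut.M cA ⊗ₖ Measurement.readOut.M cB) * ρ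
      * (Measurement.readOut.M cA ⊗ₖ Measurement.readOut.M cB)ᴴ).trace = ρ (cA, cB) (cA, cB) := by
  simp only [Measurement.readOut, single_kronecker_single, conjTranspose_single, mul_one, star_one]
  rw [Matrix.trace_mul_comm, ← Matrix.mul_assoc, single_mul_single_same,
    Matrix.trace, Finset.sum_eq_single (cA, cB)]
  · simp
  · intro b _ hb
    simp [hb]
  · simp

/-- If the result of the measurement of the first factor is ignored, then only the state of the
second one matters. -/
theorem sum_trace_kronecker_fst (E : Measurement m) (M : Matrix n n ℂ)
    (ρ : Matrix (m × n) (m × n) ℂ) :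
    ∑ o, ((E.M o ⊗ₖ M) * ρ * (E.M o ⊗ₖ M)ᴴ).trace
      = (((1 : Matrix m m ℂ) ⊗ₖ M) * ρ * ((1 : Matrix m m ℂ) ⊗ₖ M)ᴴ).trace := by
  simp_rw [trace_kronecker_eq_sum_record, trace_one_kronecker]
  rw [Finset.sum_comm]
  refine Finset.sum_congr rfl fun j _ => ?_
  rw [Finset.sum_comm]
  refine Finset.sum_congr rfl fun k _ => ?_
  rw [Finset.sum_comm]
  refine Finset.sum_congr rfl fun l _ => ?_
  rw [← Channel.sum_apply_fst E.record ρ k l, Finset.mul_sum, Finset.sum_mul]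

theorem sum_trace_readOut_snd (E : Measurement m) (c : Outcome)
    (ρ : Matrix (m × Outcome) (m × Outcome) ℂ) :
    ∑ o, ((E.M o ⊗ₖ Measurement.readOut.M c) * ρ * (E.M o ⊗ₖ Measurement.readOut.M c)ᴴ).trace
      = ∑ i, ρ (i, c) (i, c) := by
  rw [sum_trace_kronecker_fst, trace_one_kronecker, Finset.sum_eq_single c,
    Finset.sum_eq_single c, Finset.sum_eq_single c]
  · simp [Measurement.readOut]
  all_goals first
    | exact fun h => absurd (Finset.mem_univ _) h
    | intro b _ hb; simp [Measurement.readOut, Matrix.single_apply, Ne.symm hb]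

theorem sum_trace_readOut_fst (F : Measurement n) (c : Outcome)
    (ρ : Matrix (Outcome × n) (Outcome × n) ℂ) :
    ∑ o, ((Measurement.readOut.M c ⊗ₖ F.M o) * ρ * (Measurement.readOut.M c ⊗ₖ F.M o)ᴴ).trace
      = ∑ i, ρ (c, i) (c, i) := by
  -- Exchanging the two factors reduces the claim to `sum_trace_readOut_snd`.
  have h : ∀ o, ((Measurement.readOut.M c ⊗ₖ F.M o) * ρ
      * (Measurement.readOut.M c ⊗ₖ F.M o)ᴴ).trace
      = ((F.M o ⊗ₖ Measurement.readOut.M c) * ρ.submatrix Prod.swap Prod.swap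
        * (F.M o ⊗ₖ Measurement.readOut.M c)ᴴ).trace := by
    intro o
    have h2 : (F.M o ⊗ₖ Measurement.readOut.M c)
        = (Measurement.readOut.M c ⊗ₖ F.M o).submatrix (Equiv.prodComm _ _)
          (Equiv.prodComm _ _) := by
      ext ⟨a, b⟩ ⟨a', b'⟩
      simp [kroneckerMap_apply, mul_comm]
    have h3 : ρ.submatrix Prod.swap Prod.swap
        = ρ.submatrix (Equiv.prodComm n Outcome) (Equiv.prodComm n Outcome) := rfl
    rw [h2, h3, conjTranspose_submatrix, submatrix_mul_equiv, submatrix_mul_equiv]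
    exact (Fintype.sum_equiv (Equiv.prodComm n Outcome) _ _ fun _ => rfl).symm
  simp_rw [h]
  exact sum_trace_readOut_snd F c _

end States

/-! ### Truncated strategies, and the last round given the bit `a` -/

/-- The basis state `|a⟩⟨a|` of a bit. -/
abbrev bitState (a : Fin 2) : Matrix (Fin 2) (Fin 2) ℂ := Matrix.single a a 1

theorem bitState_posSemidef (a : Fin 2) : (bitState a).PosSemidef := by
  have h : bitState a = Matrix.single a a (1 : ℂ) * (Matrix.single a a (1 : ℂ))ᴴ := by
    simp [bitState]
  rw [h]
  exact posSemidef_self_mul_conjTranspose _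

/-- Play the rounds in `L` only, then output `o`. -/
def AliceStrategy.truncate (o : Outcome) {M : List (Reg × Reg)} :
    (L : List (Reg × Reg)) → {m : Reg} → AliceStrategy (L ++ M) m → AliceStrategy L m
  | [], m, _ => .finish (Measurement.const m o)
  | _ :: L, _, .round send receive rest => .round send receive (rest.truncate o L)

/-- Play the rounds in `L` only, then output `o`. -/
def BobStrategy.truncate (o : Outcome) {M : List (Reg × Reg)} :
    (L : List (Reg × Reg)) → {n : Reg} → BobStrategy (L ++ M) n → BobStrategy L n
  | [], n, _ => .finish (Measurement.const n o)
  | _ :: L, _, .round reply rest => .round reply (rest.truncate o L)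

/-- The probability that an honest Bob outputs `c` in the last round, given his result `o` of the
weak coin flip and the announced bit `a`. -/
def bobOutputWeight (p : unitInterval) (a : Fin 2) (o c : Outcome) : ℝ :=
  ∑ y, bobWeight p (o, a) (c, y)

/-- The probability that two honest players output `cA` and `cB` in the last round, given their
results of the weak coin flip and the announced bit `a`. -/
def honestWeight (p : unitInterval) (a : Fin 2) (oA oB cA cB : Outcome) : ℝ :=
  ∑ y, if cA = aliceOutput ((oA, a), y) then bobWeight p (oB, a) (cB, y) else 0

/-- Classical processing of a pair whose second component is the bit `a`. -/
theorem Channel.classical_apply_withSide {n r : Type} [Fintype n] [DecidableEq n]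
    [Fintype r] [DecidableEq r] (w : Outcome × Fin 2 → n → ℝ) (h0 h1) (a : Fin 2)
    (τ : Matrix (Outcome × r) (Outcome × r) ℂ) (t : n) (x : r) :
    (Channel.classical w h0 h1).apply (withSide (swapRight Outcome (Fin 2) r) (bitState a) τ)
      (t, x) (t, x) = ∑ o, (w (o, a) t : ℂ) * τ (o, x) (o, x) := by
  rw [Channel.classical_apply, Fintype.sum_prod_type]
  refine Finset.sum_congr rfl fun o _ => ?_
  rw [Finset.sum_eq_single a]
  · simp [withSide, swapRight, kroneckerMap_apply]
  · intro b _ hb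
    simp [withSide, swapRight, kroneckerMap_apply, hb.symm]
  · simp

/-- Bob's output depends only on his own result and on `a`, and nothing Alice does in the last round
changes his reduced state. Her part can thus be replaced by a constant measurement. -/
theorem sum_jointProb_bobLast (p : unitInterval) (a : Fin 2) {m n : Reg}
    (A : AliceStrategy [(emptyReg, bitReg)] m) (F : Measurement n)
    (ρ : Matrix (m × n) (m × n) ℂ) (cB : Outcome) :
    ∑ cA, jointProb A (bobLast p F)
        (withSide (Equiv.prodAssoc m n (Fin 2)).symm (bitState a) ρ) cA cB
      = ∑ o, jointProb (.finish (Measurement.const m (some 0))) (.finish F) ρ (some 0) o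
          * bobOutputWeight p a o cB := by
  obtain _ | @⟨_, m', _, _, _, _, send, receive, rest⟩ := A
  obtain ⟨E⟩ := rest
  simp only [bobLast, jointProb]
  rw [← Complex.re_sum, sum_trace_readOut_snd, Channel.sum_apply_fst, Channel.apply_withSide,
    pass_withSide_assoc, Channel.andThen_apply, Measurement.record_apply_withSide_receive]
  set ν : Matrix (n × m') (n × m') ℂ := (pass (send.apply ρ)).submatrix
    (fun i => ((i.1, ()), i.2)) (fun i => ((i.1, ()), i.2)) with hν
  -- No-signalling: Alice's last operation preserves Bob's reduced state, and tracing out the empty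
  -- message is a one-term sum.
  have hm : ∀ o, ∑ i, F.record.apply ν (o, i) (o, i) = _ := fun o =>
    sum_record_apply_swap F o ρ ν (by
      intro x y
      rw [← Channel.sum_apply_fst send, Fintype.sum_prod_type]
      exact Finset.sum_congr rfl fun i _ => (Fintype.sum_unique
        (fun u : Unit => send.apply ρ ((i, u), x) ((i, u), y))).symm)
  calc _ = (∑ i : m', ∑ y : Fin 2, ∑ o : Outcome, (bobWeight p (o, a) (cB, y) : ℂ)
        * F.record.apply ν (o, i) (o, i)).re := by
        rw [Fintype.sum_prod_type]
        refine congrArg Complex.re (Finset.sum_congr rfl fun i _ => Finset.sum_congr rfl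
          fun y _ => ?_)
        exact Eq.trans rfl (Channel.classical_apply_withSide (bobWeight p) (bobWeight_nonneg p)
          (bobWeight_sum p) a (F.record.apply ν) (cB, y) i)
    _ = _ := by
        simp only [Measurement.const, if_true, ← hm, bobOutputWeight]
        simp_rw [← Complex.re_mul_ofReal, ← Complex.re_sum, Complex.ofReal_sum,
          Finset.sum_mul_sum]
        rw [Finset.sum_comm (s := (Finset.univ : Finset Outcome))]
        refine congrArg Complex.re (Finset.sum_congr rfl fun i _ => ?_)
        rw [Finset.sum_comm]
        exact Finset.sum_congr rfl fun o _ => Finset.sum_congr rfl fun y _ => mul_comm _ _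

/-- Induction on the rounds of `Q`: the stored bit commutes with all operations and handovers, so
everything reduces to the last round. -/
theorem sum_jointProb_bob_extend (p : unitInterval) (a : Fin 2) (cB : Outcome) :
    ∀ {L : List (Reg × Reg)} {m n : Reg} (A : AliceStrategy (L ++ [(emptyReg, bitReg)]) m)
      (B : BobStrategy L n) (ρ : Matrix (m × n) (m × n) ℂ),
      ∑ cA, jointProb A (B.extend p)
          (withSide (Equiv.prodAssoc m n (Fin 2)).symm (bitState a) ρ) cA cB
        = ∑ o, jointProb (A.truncate (some 0) L) B ρ (some 0) o * bobOutputWeight p a o cB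
  | [], _, _, A, .finish F, ρ => sum_jointProb_bobLast p a A F ρ cB
  | _ :: _, _, _, .round send receive restA, .round reply restB, ρ => by
      rw [AliceStrategy.truncate]
      simp only [jointProb, BobStrategy.extend]
      rw [← sum_jointProb_bob_extend p a cB restA restB, Channel.apply_withSide,
        pass_withSide_assoc, Channel.apply_withSide_reply, pass_withSide_moveMid,
        Channel.apply_withSide]

/-- Honest Alice outputs a bit other than `a` only when her recorded result is `some 1`. Bob's last
reply acts after her recording and elsewhere, so it cannot alter the probability of that result. -/
theorem sum_jointProb_aliceLast_le {a c : Fin 2} (hc : c ≠ a) {m n : Reg} (E : Measurement m)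
    (B : BobStrategy [(emptyReg, bitReg)] n)
    {ρ : Matrix (m × n) (m × n) ℂ} (hρ : ρ.PosSemidef) :
    ∑ cB, jointProb (aliceLast E) B (withSide (swapRight m (Fin 2) n) (bitState a) ρ) (some c) cB
      ≤ jointProb (.finish E) (.finish (Measurement.const n (some 1))) ρ (some 1) (some 1) := by
  obtain _ | @⟨_, n', _, _, _, reply, rest⟩ := B
  obtain ⟨F⟩ := rest
  simp only [aliceLast, jointProb]
  rw [← Complex.re_sum, sum_trace_readOut_fst, Measurement.record_apply_withSide_send,
    pass_withSide_moveMid]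
  set τ := E.record.apply ρ with hτ
  have hτ0 : τ.PosSemidef := Channel.apply_posSemidef _ hρ
  set R : Matrix ((n × Unit) × (Outcome × Fin 2)) ((n × Unit) × (Outcome × Fin 2)) ℂ :=
    withSide (Equiv.prodAssoc _ _ _).symm (bitState a)
      (pass (τ.submatrix (fun i => (i.1.1, i.2)) (fun i => (i.1.1, i.2)))) with hR
  have hR0 : R.PosSemidef :=
    withSide_posSemidef _ (bitState_posSemidef a) (pass_posSemidef (hτ0.submatrix _))
  have hd : ∀ x, 0 ≤ reply.apply R x x := fun x => (Channel.apply_posSemidef _ hR0).diag_nonneg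
  -- Tracing out Bob undoes the effect of his reply and leaves Alice's recorded pair, whose second
  -- entry is still `a`.
  have hq : ∀ q : Outcome × Fin 2, ∑ t, reply.apply R (t, q) (t, q)
      = if q.2 = a then ∑ i, τ (q.1, i) (q.1, i) else 0 := by
    intro q
    rw [Channel.sum_apply_fst, Fintype.sum_prod_type]
    split_ifs with h
    · refine Finset.sum_congr rfl fun i _ => ?_
      simp [hR, withSide, pass, kroneckerMap_apply, h]
    · refine Finset.sum_eq_zero fun i _ => ?_
      simp [hR, withSide, pass, kroneckerMap_apply, Ne.symm h]
  have hle : ∑ i : n', ∑ q : Outcome × Fin 2, ∑ y : Fin 2,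
      (if some c = aliceOutput (q, y) then reply.apply R ((i, y), q) ((i, y), q) else 0)
      ≤ ∑ q : Outcome × Fin 2, if q = (some 1, a) then
          ∑ t, reply.apply R (t, q) (t, q) else 0 := by
    rw [Finset.sum_comm]
    refine Finset.sum_le_sum fun q _ => ?_
    rw [← Fintype.sum_prod_type']
    by_cases hqa : q.2 = a
    · split_ifs with h
      · refine Finset.sum_le_sum fun t _ => ?_
        split_ifs
        · exact le_rfl
        · exact hd _
      · refine (Finset.sum_eq_zero fun t _ => if_neg ?_).le
        obtain ⟨o, b⟩ := q
        simp only at hqa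
        subst hqa
        unfold aliceOutput
        split_ifs with h0 h1
        · simpa using hc
        · exact fun _ => h (by simpa using h1)
        · simp
    -- Nonnegative diagonal entries with sum zero all vanish.
    · have h0 : ∀ t, reply.apply R (t, q) (t, q) = 0 := fun t =>
        (Finset.sum_eq_zero_iff_of_nonneg fun t _ => hd _).1
          ((hq q).trans (if_neg hqa)) t (Finset.mem_univ _)
      simp [h0]
  calc _ = (∑ i : n', ∑ q : Outcome × Fin 2, ∑ y : Fin 2,
      (if some c = aliceOutput (q, y) then reply.apply R ((i, y), q) ((i, y), q) else 0)).re := by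
        refine congrArg Complex.re (Finset.sum_congr rfl fun i _ => ?_)
        rw [Channel.function_apply, Fintype.sum_prod_type]
        rfl
    _ ≤ _ := (Complex.le_def.1 hle).1
    _ = _ := by
        rw [Finset.sum_ite_eq' Finset.univ ((some 1, a) : Outcome × Fin 2)
          (fun q => ∑ t, reply.apply R (t, q) (t, q))]
        rw [if_pos (Finset.mem_univ _), hq, if_pos rfl]
        simp only [Measurement.const, if_true, hτ, sum_record_apply]

theorem sum_jointProb_alice_extend_le {a c : Fin 2} (hc : c ≠ a) :
    ∀ {L : List (Reg × Reg)} {m n : Reg} (A : AliceStrategy L m)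
      (B : BobStrategy (L ++ [(emptyReg, bitReg)]) n) {ρ : Matrix (m × n) (m × n) ℂ},
      ρ.PosSemidef →
      ∑ cB, jointProb A.extend B (withSide (swapRight m (Fin 2) n) (bitState a) ρ) (some c) cB
        ≤ jointProb A (B.truncate (some 1) L) ρ (some 1) (some 1)
  | [], _, _, .finish E, B, _, hρ => sum_jointProb_aliceLast_le hc E B hρ
  | _ :: _, _, _, .round send receive restA, .round reply restB, _, hρ => by
      rw [BobStrategy.truncate]
      simp only [jointProb, AliceStrategy.extend]
      rw [Channel.apply_withSide_send, pass_withSide_moveMid, Channel.apply_withSide,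
        pass_withSide_assoc, Channel.apply_withSide_receive]
      exact sum_jointProb_alice_extend_le hc restA restB (Channel.apply_posSemidef _
        (pass_posSemidef (Channel.apply_posSemidef _ (pass_posSemidef
          (Channel.apply_posSemidef _ hρ)))))

/-- Each player holds a copy of `a`, hence the two nested `withSide`. Once both results are
recorded, the last round is a stochastic map; the weight is not a product because the transmitted
bit `y` enters both outputs. -/
theorem jointProb_last (p : unitInterval) (a : Fin 2) {m n : Reg}
    (E : Measurement m) (F : Measurement n) (ρ : Matrix (m × n) (m × n) ℂ) (cA cB : Outcome) :
    jointProb (aliceLast E) (bobLast p F) (withSide (swapRight m (Fin 2) (n × Fin 2)) (bitState a)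
        (withSide (Equiv.prodAssoc m n (Fin 2)).symm (bitState a) ρ)) cA cB
      = ∑ oA, ∑ oB, jointProb (.finish E) (.finish F) ρ oA oB * honestWeight p a oA oB cA cB := by
  simp only [aliceLast, bobLast, jointProb]
  rw [trace_readOut, Measurement.record_apply_withSide_send, Channel.apply_withSide,
    Channel.function_apply]
  set ν : Matrix (n × Outcome) (n × Outcome) ℂ :=
    (E.record.apply ρ).submatrix Prod.swap Prod.swap with hν
  have hB : ∀ (q : Outcome × Fin 2) (y : Fin 2),
      (((F.record.tensorId (Fin 2)).reindex (Equiv.prodPUnit _) (Equiv.refl _)).andThen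
        (Channel.classical (bobWeight p) (bobWeight_nonneg p) (bobWeight_sum p))).apply
        (pass (withSide (moveMid Outcome (Fin 2) Unit (n × Fin 2)) (bitState a)
          ((withSide (Equiv.prodAssoc Outcome n (Fin 2)).symm (bitState a)
            (E.record.apply ρ)).submatrix
              (fun i => (i.1.1, i.2)) (fun i => (i.1.1, i.2)))))
        ((cB, y), q) ((cB, y), q)
      = if q.2 = a then ∑ o, (bobWeight p (o, a) (cB, y) : ℂ)
          * F.record.apply ν (o, q.1) (o, q.1) else 0 := by
    intro q y
    have h1 : pass (withSide (moveMid Outcome (Fin 2) Unit (n × Fin 2)) (bitState a)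
          ((withSide (Equiv.prodAssoc Outcome n (Fin 2)).symm (bitState a)
            (E.record.apply ρ)).submatrix
              (fun i => (i.1.1, i.2)) (fun i => (i.1.1, i.2))))
        = withSide (Equiv.prodAssoc _ _ _).symm (bitState a)
          (withSide (moveMid n (Fin 2) Unit Outcome) (bitState a)
            (ν.submatrix (fun i => (i.1.1, i.2)) (fun i => (i.1.1, i.2)))) := rfl
    rw [h1, Channel.apply_withSide, Channel.andThen_apply,
      Measurement.record_apply_withSide_receive]
    have h2 : ∀ (X : Matrix ((Outcome × Fin 2) × Outcome) ((Outcome × Fin 2) × Outcome) ℂ) t,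
        withSide (Equiv.prodAssoc (Outcome × Fin 2) Outcome (Fin 2)).symm (bitState a) X
          (t, q) (t, q) = if q.2 = a then X (t, q.1) (t, q.1) else 0 := by
      intro X t
      split_ifs with h
      · simp [withSide, kroneckerMap_apply, h]
      · simp [withSide, kroneckerMap_apply, Ne.symm h]
    rw [h2, Channel.classical_apply_withSide]
    rfl
  -- Recording the two results one after the other gives the statistics of the product measurement.
  have hτ : ∀ oA oB, F.record.apply ν (oB, oA) (oB, oA)
      = ((E.M oA ⊗ₖ F.M oB) * ρ * (E.M oA ⊗ₖ F.M oB)ᴴ).trace := by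
    intro oA oB
    rw [trace_kronecker_eq_sum_record, Measurement.record_apply]
    exact Finset.sum_congr rfl fun j _ => kronecker_one_mul_mul_apply _ _ _ _
  calc _ = (∑ q : Outcome × Fin 2, ∑ y : Fin 2, if cA = aliceOutput (q, y) then
        (if q.2 = a then ∑ o, (bobWeight p (o, a) (cB, y) : ℂ)
          * F.record.apply ν (o, q.1) (o, q.1) else 0) else 0).re := by
        rw [Fintype.sum_prod_type]
        refine congrArg Complex.re (Finset.sum_congr rfl fun q _ => Finset.sum_congr rfl
          fun y _ => ?_)
        rw [← hB]
        rfl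
    _ = _ := by
        rw [Fintype.sum_prod_type, Complex.re_sum]
        refine Finset.sum_congr rfl fun oA _ => ?_
        rw [Finset.sum_eq_single a]
        · simp only [if_true, hτ, honestWeight]
          simp_rw [← Complex.re_mul_ofReal, ← Complex.re_sum, Complex.ofReal_sum]
          refine congrArg Complex.re ?_
          simp_rw [Finset.mul_sum]
          rw [Finset.sum_comm]
          refine Finset.sum_congr rfl fun y _ => ?_
          split_ifs
          · exact Finset.sum_congr rfl fun o _ => mul_comm _ _
          · simp
        · intro b _ hb
          simp [hb]
        · simp

theorem jointProb_extend (p : unitInterval) (a : Fin 2) (cA cB : Outcome) :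
    ∀ {L : List (Reg × Reg)} {m n : Reg} (A : AliceStrategy L m) (B : BobStrategy L n)
      (ρ : Matrix (m × n) (m × n) ℂ),
      jointProb A.extend (B.extend p) (withSide (swapRight m (Fin 2) (n × Fin 2)) (bitState a)
          (withSide (Equiv.prodAssoc m n (Fin 2)).symm (bitState a) ρ)) cA cB
        = ∑ oA, ∑ oB, jointProb A B ρ oA oB * honestWeight p a oA oB cA cB
  | [], _, _, .finish E, .finish F, ρ => jointProb_last p a E F ρ cA cB
  | _ :: _, _, _, .round send receive restA, .round reply restB, ρ => by
      simp only [jointProb, AliceStrategy.extend, BobStrategy.extend]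
      rw [← jointProb_extend p a cA cB restA restB, Channel.apply_withSide_send,
        pass_withSide_moveMid, Channel.apply_withSide, Channel.apply_withSide, pass_withSide_assoc,
        pass_withSide_assoc, Channel.apply_withSide_reply, pass_withSide_moveMid,
        Channel.apply_withSide_receive, Channel.apply_withSide]

/-! ### Linearity in the state, and the first round -/

section States

variable {m n k r S : Type} [Fintype m] [DecidableEq m] [Fintype n] [DecidableEq n]
  [Fintype k] [DecidableEq k] [Fintype r] [DecidableEq r] [Fintype S] [DecidableEq S]

theorem Channel.apply_sum_smul {ι : Type} [Fintype ι] (Φ : Channel m n) (c : ι → ℂ)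
    (ρ : ι → Matrix (m × r) (m × r) ℂ) :
    Φ.apply (∑ i, c i • ρ i) = ∑ i, c i • Φ.apply (ρ i) := by
  simp only [Channel.apply, Matrix.mul_sum, Matrix.sum_mul, Finset.smul_sum, Matrix.mul_smul,
    Matrix.smul_mul]
  exact Finset.sum_comm

theorem pass_sum_smul {ι p x q : Type} [Fintype ι] (c : ι → ℂ)
    (ρ : ι → Matrix ((p × x) × q) ((p × x) × q) ℂ) :
    pass (∑ i, c i • ρ i) = ∑ i, c i • pass (ρ i) := by
  ext a b
  simp [pass, Matrix.sum_apply]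

/-- Serves three purposes: splitting over the announced bit, rescaling unnormalized states (one
index), and vanishing at the zero state (no index). -/
theorem jointProb_sum_smul {ι : Type} [Fintype ι] (c : ι → ℝ) :
    ∀ {L : List (Reg × Reg)} {m n : Reg} (A : AliceStrategy L m) (B : BobStrategy L n)
      (ρ : ι → Matrix (m × n) (m × n) ℂ) (cA cB : Outcome),
      jointProb A B (∑ i, (c i : ℂ) • ρ i) cA cB = ∑ i, c i * jointProb A B (ρ i) cA cB
  | [], _, _, .finish E, .finish F, ρ, cA, cB => by
      simp only [jointProb, Matrix.mul_sum, Matrix.sum_mul, Matrix.mul_smul, Matrix.smul_mul,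
        trace_sum, trace_smul, Complex.re_sum, smul_eq_mul, Complex.re_ofReal_mul]
  | _ :: _, _, _, .round _ _ restA, .round _ restB, ρ, cA, cB => by
      simp only [jointProb, Channel.apply_sum_smul, pass_sum_smul]
      exact jointProb_sum_smul c restA restB _ cA cB

/-- The operation applied to a state of its input register alone. -/
def Channel.map (Φ : Channel m n) (ρ : Matrix m m ℂ) : Matrix n n ℂ :=
  ∑ i, Φ.K i * ρ * (Φ.K i)ᴴ

theorem Channel.apply_kronecker (Φ : Channel m n) (ρ : Matrix m m ℂ) (τ : Matrix r r ℂ) :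
    Φ.apply (ρ ⊗ₖ τ) = Φ.map ρ ⊗ₖ τ := by
  simp only [Channel.apply, Channel.map, conjTranspose_kronecker, ← mul_kronecker_mul]
  ext x y
  simp [Matrix.sum_apply, kroneckerMap_apply, Finset.sum_mul]

theorem Channel.map_posSemidef (Φ : Channel m n) {ρ : Matrix m m ℂ} (h : ρ.PosSemidef) :
    (Φ.map ρ).PosSemidef :=
  Matrix.posSemidef_sum _ fun _ _ => h.mul_mul_conjTranspose_same _

theorem Channel.trace_map (Φ : Channel m n) (ρ : Matrix m m ℂ) : (Φ.map ρ).trace = ρ.trace := by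
  unfold Channel.map
  rw [trace_sum]
  simp_rw [fun i => trace_mul_comm (Φ.K i * ρ) (Φ.K i)ᴴ, ← Matrix.mul_assoc]
  rw [← trace_sum, ← Matrix.sum_mul, Φ.complete, Matrix.one_mul]

theorem sum_kraus_submatrix {ι α β α' β' : Type} [Fintype ι] [Fintype α] [Fintype α']
    (K : ι → Matrix β α ℂ) (K' : ι → Matrix β' α' ℂ) (e : α' ≃ α) (f : β' → β)
    (h : ∀ i, K' i = (K i).submatrix f e) (ρ : Matrix α α ℂ) :
    ∑ i, K' i * ρ.submatrix e e * (K' i)ᴴ = (∑ i, K i * ρ * (K i)ᴴ).submatrix f f := by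
  simp_rw [h, conjTranspose_submatrix, submatrix_mul_equiv]
  ext x y
  simp [Matrix.sum_apply]

/-- Each Kraus operator has a single nonzero row, so no coherence between distinct outputs survives.
-/
theorem Channel.classical_apply_of_ne (w : m → n → ℝ) (h0 h1) (ρ : Matrix (m × r) (m × r) ℂ)
    {t t' : n} (h : t ≠ t') (x y : r) :
    (Channel.classical w h0 h1).apply ρ (t, x) (t', y) = 0 := by
  rw [Channel.apply_apply]
  refine Finset.sum_eq_zero fun k _ => Finset.sum_eq_zero fun i _ =>
    Finset.sum_eq_zero fun j _ => ?_
  change Matrix.single k.2 k.1 ((Real.sqrt (w k.1 k.2) : ℝ) : ℂ) t i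
    * ρ (i, x) (j, y) * star (Matrix.single k.2 k.1 ((Real.sqrt (w k.1 k.2) : ℝ) : ℂ) t' j) = _
  by_cases hk : k.2 = t
  · simp [Matrix.single_apply, hk, h]
  · simp [Matrix.single_apply, hk]

/-- Deterministic classical processing of the first register. -/
theorem Channel.function_apply_eq_sum (f : m → n) (ρ : Matrix (m × r) (m × r) ℂ) :
    (Channel.function f).apply ρ
      = ∑ s, (Matrix.single (f s) (f s) (1 : ℂ)) ⊗ₖ ρ.submatrix (Prod.mk s) (Prod.mk s) := by
  ext ⟨t, x⟩ ⟨t', y⟩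
  rw [Matrix.sum_apply]
  by_cases h : t = t'
  · subst h
    rw [Channel.function_apply]
    refine Finset.sum_congr rfl fun s _ => ?_
    simp [kroneckerMap_apply, Matrix.single_apply, eq_comm]
  · rw [Channel.function, Channel.classical_apply_of_ne _ _ _ _ h]
    refine (Finset.sum_eq_zero fun s _ => ?_).symm
    simp only [kroneckerMap_apply, Matrix.single_apply]
    rw [if_neg, zero_mul]
    rintro ⟨rfl, rfl⟩
    exact h rfl

/-- Honest Alice announces her random bit. -/
theorem announce_apply (α : Matrix m m ℂ) (β : Matrix n n ℂ) :
    (((Channel.function (fun a : Fin 2 => (a, a))).tensorId m).reindex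
        (Equiv.prodComm _ _) ((Equiv.prodAssoc _ _ _).trans (Equiv.prodComm _ _))).apply
      ((α ⊗ₖ ((1 / 2 : ℂ) • (1 : Matrix (Fin 2) (Fin 2) ℂ))) ⊗ₖ β)
    = ∑ a, ((1 / 2 : ℝ) : ℂ) • (((α ⊗ₖ bitState a) ⊗ₖ bitState a) ⊗ₖ β) := by
  -- In these coordinates the bits come first, and the operation is the copying map tensored with
  -- the identity on both memories.
  let e : (m × Fin 2) × n ≃ Fin 2 × (m × n) :=
    ((Equiv.prodComm m (Fin 2)).prodCongr (Equiv.refl n)).trans (Equiv.prodAssoc _ _ _)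
  let f : ((m × Fin 2) × Fin 2) × n → (Fin 2 × Fin 2) × (m × n) :=
    fun i => ((i.1.1.2, i.1.2), (i.1.1.1, i.2))
  have h1 : ((α ⊗ₖ ((1 / 2 : ℂ) • (1 : Matrix (Fin 2) (Fin 2) ℂ))) ⊗ₖ β)
      = (((1 / 2 : ℂ) • (1 : Matrix (Fin 2) (Fin 2) ℂ)) ⊗ₖ (α ⊗ₖ β)).submatrix e e := by
    ext ⟨⟨i, a⟩, j⟩ ⟨⟨i', a'⟩, j'⟩
    simp [e, kroneckerMap_apply]
    ring
  rw [h1]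
  refine (sum_kraus_submatrix (fun i => (Channel.function (fun a : Fin 2 => (a, a))).K i
    ⊗ₖ (1 : Matrix (m × n) (m × n) ℂ)) _ e f (fun i => ?_) _).trans ?_
  · ext ⟨⟨⟨i, a⟩, b⟩, j⟩ ⟨⟨i', a'⟩, j'⟩
    simp [e, f, kroneckerMap_apply, Matrix.one_apply, Channel.tensorId, Channel.reindex, ite_and]
    split_ifs <;> rfl
  · change ((Channel.function (fun a : Fin 2 => (a, a))).apply _).submatrix f f = _
    rw [Channel.function_apply_eq_sum]
    ext ⟨⟨⟨i, a⟩, b⟩, j⟩ ⟨⟨⟨i', a'⟩, b'⟩, j'⟩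
    have h2 : ∀ s : Fin 2, Matrix.single (s, s) (s, s) (1 : ℂ) = bitState s ⊗ₖ bitState s := by
      simp [bitState, single_kronecker_single]
    simp only [submatrix_apply, Matrix.sum_apply, Matrix.smul_apply, kroneckerMap_apply, f, h2,
      smul_eq_mul, Matrix.one_apply_eq]
    refine Finset.sum_congr rfl fun s _ => ?_
    push_cast
    ring

/-- Honest Bob reads the announced bit. -/
theorem readBit_apply (β : Matrix n n ℂ) (ω : Matrix (m × Fin 2) (m × Fin 2) ℂ) :
    (((Channel.function (fun a : Fin 2 => a)).tensorId n).reindex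
        (Equiv.prodComm _ _) ((Equiv.prodPUnit _).trans (Equiv.prodComm _ _))).apply
      (pass (ω ⊗ₖ β))
    = ∑ a, ((1 : ℝ) : ℂ) • ((β ⊗ₖ bitState a) ⊗ₖ
        (ω.submatrix (fun i => (i, a)) (fun i => (i, a)))).submatrix
          (fun i : ((n × Fin 2) × Unit) × m => (i.1.1, i.2)) (fun i => (i.1.1, i.2)) := by
  let e : (n × Fin 2) × m ≃ Fin 2 × (n × m) :=
    ((Equiv.prodComm n (Fin 2)).prodCongr (Equiv.refl m)).trans (Equiv.prodAssoc _ _ _)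
  let f : ((n × Fin 2) × Unit) × m → Fin 2 × (n × m) :=
    fun i => (i.1.1.2, (i.1.1.1, i.2))
  have h1 : pass (ω ⊗ₖ β) = ((ω ⊗ₖ β).submatrix
      (fun i : Fin 2 × (n × m) => ((i.2.2, i.1), i.2.1))
      (fun i : Fin 2 × (n × m) => ((i.2.2, i.1), i.2.1))).submatrix e e := rfl
  rw [h1]
  refine (sum_kraus_submatrix (fun i => (Channel.function (fun a : Fin 2 => a)).K i
    ⊗ₖ (1 : Matrix (n × m) (n × m) ℂ)) _ e f (fun i => ?_) _).trans ?_
  · ext ⟨⟨⟨i, a⟩, b⟩, j⟩ ⟨⟨i', a'⟩, j'⟩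
    simp [e, f, kroneckerMap_apply, Matrix.one_apply, Channel.tensorId, Channel.reindex, ite_and]
    split_ifs <;> rfl
  · change ((Channel.function (fun a : Fin 2 => a)).apply _).submatrix f f = _
    rw [Channel.function_apply_eq_sum]
    ext ⟨⟨⟨i, a⟩, b⟩, j⟩ ⟨⟨⟨i', a'⟩, b'⟩, j'⟩
    simp only [submatrix_apply, Matrix.sum_apply, Matrix.smul_apply, kroneckerMap_apply, f,
      smul_eq_mul, Complex.ofReal_one]
    refine Finset.sum_congr rfl fun s _ => ?_
    ring

theorem Channel.id_apply_prodPUnit (ρ : Matrix ((m × Unit) × r) ((m × Unit) × r) ℂ) :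
    ((Channel.id m).reindex (Equiv.prodPUnit _) (Equiv.refl _)).apply ρ
      = ρ.submatrix (fun i => ((i.1, ()), i.2)) (fun i => ((i.1, ()), i.2)) := by
  ext ⟨i, x⟩ ⟨j, y⟩
  rw [Channel.apply_apply]
  change ∑ _k : Unit, ∑ u : m × Unit, ∑ v : m × Unit, (1 : Matrix m m ℂ) i u.1 * ρ (u, x) (v, y)
    * star ((1 : Matrix m m ℂ) j v.1) = _
  simp [Fintype.sum_prod_type, Matrix.one_apply]

end States

/-- The state of Bob's memory after his first reply to the honest Alice who announced `a`. -/
def bobReplyState {n n' : Type} [Fintype n] [DecidableEq n] [Fintype n'] [DecidableEq n']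
    (β : Density n) (reply : Channel (n × Fin 2) (n' × Unit)) (a : Fin 2) : Density n' where
  mat := (reply.map (β.mat ⊗ₖ bitState a)).submatrix (fun i => (i, ())) (fun i => (i, ()))
  pos := (reply.map_posSemidef (β.pos.kronecker (bitState_posSemidef a))).submatrix _
  trace_eq_one := by
    have h : (reply.map (β.mat ⊗ₖ bitState a)).trace = 1 := by
      rw [Channel.trace_map, trace_kronecker, β.trace_eq_one]
      simp
    rw [← h]
    exact Fintype.sum_equiv (Equiv.prodPUnit n').symm _ _ fun _ => rfl

/-- Alice's bit is independent of her memory for `Q`. Given `a`, Bob's memory after his reply is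
therefore uncorrelated with hers and is an admissible initial state for cheating in `Q`. -/
theorem jointProb_strongAlice {L : List (Reg × Reg)} (A : Alice L) {n n' : Reg} (β : Density n)
    (reply : Channel (n × bitReg) (n' × emptyReg))
    (rest : BobStrategy (L ++ [(emptyReg, bitReg)]) n') (cA cB : Outcome) :
    jointProb (strongAlice A).strategy (.round reply rest) ((strongAlice A).init.mat ⊗ₖ β.mat)
        cA cB
      = ∑ a, 1 / 2 * jointProb A.strategy.extend rest (withSide (swapRight A.mem (Fin 2) n')
          (bitState a) (A.init.mat ⊗ₖ (bobReplyState β reply a).mat)) cA cB := by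
  rw [← jointProb_sum_smul]
  simp only [strongAlice, jointProb, Density.withRandomBit]
  rw [announce_apply, pass_sum_smul, Channel.apply_sum_smul, pass_sum_smul,
    Channel.id_apply_prodPUnit]
  congr 1
  ext x y
  simp only [submatrix_apply, Matrix.sum_apply, Matrix.smul_apply]
  refine Finset.sum_congr rfl fun a _ => ?_
  congr 1
  have h : pass (((A.init.mat ⊗ₖ bitState a) ⊗ₖ bitState a) ⊗ₖ β.mat)
      = (β.mat ⊗ₖ bitState a) ⊗ₖ (A.init.mat ⊗ₖ bitState a) := by
    ext ⟨⟨i, b⟩, j, b'⟩ ⟨⟨i', c⟩, j', c'⟩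
    simp only [pass, submatrix_apply, kroneckerMap_apply]
    ring
  erw [h, Channel.apply_kronecker]
  simp only [pass, submatrix_apply, kroneckerMap_apply, withSide, swapRight, bobReplyState,
    Equiv.coe_fn_mk]
  ring

/-- Alice's memory after the first round with the honest Bob who read the bit `a`
(not normalized). -/
def aliceSendState {m m' m'' : Type} [Fintype m] [DecidableEq m] [Fintype m'] [DecidableEq m']
    [Fintype m''] (α : Matrix m m ℂ) (send : Channel m (m' × Fin 2))
    (receive : Channel (m' × Unit) m'') (a : Fin 2) : Matrix m'' m'' ℂ :=
  receive.map ((send.map α).submatrix (fun i => (i.1, a)) (fun i => (i.1, a)))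

theorem aliceSendState_posSemidef {m m' m'' : Type} [Fintype m] [DecidableEq m] [Fintype m']
    [DecidableEq m'] [Fintype m''] [DecidableEq m''] {α : Matrix m m ℂ} (hα : α.PosSemidef)
    (send : Channel m (m' × Fin 2)) (receive : Channel (m' × Unit) m'') (a : Fin 2) :
    (aliceSendState α send receive a).PosSemidef :=
  receive.map_posSemidef ((send.map_posSemidef hα).submatrix _)

/-- For a density matrix `α`, the trace of `aliceSendState` is the probability that Bob reads `a`;
these probabilities add up to one. -/
theorem sum_trace_aliceSendState {m m' m'' : Type} [Fintype m] [DecidableEq m] [Fintype m']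
    [DecidableEq m'] [Fintype m''] [DecidableEq m''] (α : Matrix m m ℂ)
    (send : Channel m (m' × Fin 2)) (receive : Channel (m' × Unit) m'') :
    ∑ a, (aliceSendState α send receive a).trace = α.trace := by
  simp_rw [aliceSendState, Channel.trace_map]
  rw [← Channel.trace_map send α, Matrix.trace, Fintype.sum_prod_type_right]
  refine Finset.sum_congr rfl fun a _ => ?_
  exact Fintype.sum_equiv (Equiv.prodPUnit m') _ _ fun _ => rfl

/-- Reading the message in the computational basis destroys any superposition of the two bits, and
Bob's memory is still uncorrelated with Alice's. The probability of `a` sits in the unnormalized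
state, so no prefactor appears. -/
theorem jointProb_strongBob (p : unitInterval) {L : List (Reg × Reg)} (B : Bob L)
    {m m' m'' : Reg} (α : Matrix m m ℂ) (send : Channel m (m' × bitReg))
    (receive : Channel (m' × emptyReg) m'')
    (rest : AliceStrategy (L ++ [(emptyReg, bitReg)]) m'') (cA cB : Outcome) :
    jointProb (.round send receive rest) (strongBob p B).strategy
        (α ⊗ₖ (strongBob p B).init.mat) cA cB
      = ∑ a, jointProb rest (B.strategy.extend p) (withSide (Equiv.prodAssoc m'' B.mem _).symm
          (bitState a) (aliceSendState α send receive a ⊗ₖ B.init.mat)) cA cB := by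
  have h1 := jointProb_sum_smul (fun _ : Fin 2 => (1 : ℝ)) rest (B.strategy.extend p)
    (fun a => withSide (Equiv.prodAssoc m'' B.mem (Fin 2)).symm
          (bitState a) (aliceSendState α send receive a ⊗ₖ B.init.mat)) cA cB
  simp only [one_mul] at h1
  rw [← h1]
  simp only [strongBob, jointProb]
  rw [Channel.apply_kronecker, readBit_apply, pass_sum_smul, Channel.apply_sum_smul]
  congr 1
  refine Finset.sum_congr rfl fun a _ => ?_
  congr 1
  have h : pass (((B.init.mat ⊗ₖ bitState a) ⊗ₖ
        ((send.map α).submatrix (fun i => (i, a)) (fun i => (i, a)))).submatrix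
          (fun i : ((B.mem × Fin 2) × Unit) × m' => (i.1.1, i.2)) (fun i => (i.1.1, i.2)))
      = withSide (Equiv.prodAssoc (m' × Unit) B.mem (Fin 2)).symm (bitState a)
        ((send.map α).submatrix (fun i => (i.1, a)) (fun i => (i.1, a)) ⊗ₖ B.init.mat) := by
    ext ⟨⟨i, b⟩, j, b'⟩ ⟨⟨i', c⟩, j', c'⟩
    simp only [pass, submatrix_apply, kroneckerMap_apply, withSide, Equiv.prodAssoc_symm_apply]
    ring
  erw [h, Channel.apply_withSide, Channel.apply_kronecker]
  rfl

/-! ### Cheating bounds and the honest run -/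

theorem prob_some {L : List (Reg × Reg)} (A : Alice L) (B : Bob L) (c : Fin 2) :
    prob A B (some c)
      = jointProb A.strategy B.strategy (A.init.mat ⊗ₖ B.init.mat) (some c) (some c) := by
  unfold prob
  rw [Finset.sum_eq_single (some c), Finset.sum_eq_single (some c)]
  · simp [combine]
  · intro b _ hb
    simp [combine, hb.symm]
  · simp
  · intro b _ hb
    refine Finset.sum_eq_zero fun b' _ => if_neg ?_
    unfold combine
    split_ifs <;> simp [hb]
  · simp

/-- A cheating Alice wins with probability at most `weakCheatA`, also with an unnormalized
initial state. -/
theorem jointProb_le_weakCheatA (Q : Protocol) {m : Reg} (A : AliceStrategy Q.rounds m)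
    {α : Matrix m m ℂ} (hα : α.PosSemidef) :
    jointProb A Q.bob.strategy (α ⊗ₖ Q.bob.init.mat) (some 0) (some 0)
      ≤ Q.weakCheatA * α.trace.re := by
  have hbdd : BddAbove (Set.range fun A : Alice Q.rounds => prob A Q.bob (some 0)) :=
    ⟨1, by rintro _ ⟨A, rfl⟩; exact prob_le_one _ _ _⟩
  obtain ⟨ht, hi⟩ := Complex.le_def.1 hα.trace_nonneg
  have htr : α.trace = (α.trace.re : ℂ) := Complex.ext rfl hi.symm
  -- A bit announced with probability zero gives the zero state; otherwise the state is normalized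
  -- to form an actual cheating Alice.
  rcases ht.eq_or_lt with h0 | h0
  · have hz : α = 0 := hα.trace_eq_zero_iff.1 (by rw [htr, ← h0]; simp)
    have h2 := jointProb_sum_smul (fun i : Empty => (0 : ℝ)) A Q.bob.strategy
      (fun _ => 0) (some 0) (some 0)
    simp only [Finset.univ_eq_empty, Finset.sum_empty] at h2
    simp [hz, h2]
  · let A' : Alice Q.rounds :=
      { mem := m
        init :=
          { mat := ((α.trace.re⁻¹ : ℝ) : ℂ) • α
            pos := hα.smul (Complex.zero_le_real.2 (inv_pos.2 h0).le)
            trace_eq_one := by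
              rw [trace_smul, smul_eq_mul]
              nth_rewrite 2 [htr]
              rw [← Complex.ofReal_mul, inv_mul_cancel₀ h0.ne', Complex.ofReal_one] }
        strategy := A }
    have h1 : prob A' Q.bob (some 0) ≤ Q.weakCheatA := le_ciSup hbdd A'
    rw [prob_some] at h1
    have h2 := jointProb_sum_smul (fun _ : Unit => α.trace.re⁻¹) A Q.bob.strategy
      (fun _ => α ⊗ₖ Q.bob.init.mat) (some 0) (some 0)
    simp only [Finset.univ_unique, Finset.sum_singleton] at h2
    rw [← smul_kronecker] at h2
    rw [h2, inv_mul_le_iff₀ h0, mul_comm] at h1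
    exact h1

theorem jointProb_le_weakCheatB (Q : Protocol) {n : Reg} (B : BobStrategy Q.rounds n)
    (β : Density n) :
    jointProb Q.alice.strategy B (Q.alice.init.mat ⊗ₖ β.mat) (some 1) (some 1)
      ≤ Q.weakCheatB := by
  have hbdd : BddAbove (Set.range fun B : Bob Q.rounds => prob Q.alice B (some 1)) :=
    ⟨1, by rintro _ ⟨B, rfl⟩; exact prob_le_one _ _ _⟩
  have h := le_ciSup hbdd ⟨n, β, B⟩
  rw [prob_some] at h
  exact h

theorem bobOutputWeight_zero (p : unitInterval) (a c : Fin 2) :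
    bobOutputWeight p a (some 0) (some c) = if c = a then 1 else 0 := by
  fin_cases a <;> fin_cases c <;> simp [bobOutputWeight, bobWeight]

theorem bobOutputWeight_one (p : unitInterval) (a c : Fin 2) :
    bobOutputWeight p a (some 1) (some c) = if c = a then (p : ℝ) else 1 - p := by
  fin_cases a <;> fin_cases c <;> simp [bobOutputWeight, bobWeight]

theorem bobOutputWeight_none (p : unitInterval) (a c : Fin 2) :
    bobOutputWeight p a none (some c) = 0 := by
  simp [bobOutputWeight, bobWeight]

theorem honestWeight_zero (p : unitInterval) (a c : Fin 2) :
    honestWeight p a (some 0) (some 0) (some c) (some c) = if c = a then 1 else 0 := by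
  fin_cases a <;> fin_cases c <;> simp [honestWeight, bobWeight, aliceOutput]

theorem honestWeight_one (p : unitInterval) (a c : Fin 2) :
    honestWeight p a (some 1) (some 1) (some c) (some c) = if c = a then (p : ℝ) else 1 - p := by
  fin_cases a <;> fin_cases c <;> simp [honestWeight, bobWeight, aliceOutput]

theorem jointProb_le_trace {L : List (Reg × Reg)} {m n : Reg} (A : AliceStrategy L m)
    (B : BobStrategy L n) {ρ : Matrix (m × n) (m × n) ℂ} (hρ : ρ.PosSemidef) (cA : Outcome) :
    ∑ cB, jointProb A B ρ cA cB ≤ ρ.trace.re := by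
  rw [← sum_jointProb A B ρ]
  exact Finset.single_le_sum (f := fun cA => ∑ cB, jointProb A B ρ cA cB)
    (fun cA _ => Finset.sum_nonneg fun cB _ => jointProb_nonneg A B hρ cA cB) (Finset.mem_univ cA)

theorem trace_withSide_bitState {α' α : Type} [Fintype α] [Fintype α'] (e : α' ≃ α × Fin 2)
    (a : Fin 2) (ρ : Matrix α α ℂ) : (withSide e (bitState a) ρ).trace = ρ.trace := by
  have h : (withSide e (bitState a) ρ).trace = (ρ ⊗ₖ bitState a).trace :=
    Fintype.sum_equiv e _ _ fun _ => rfl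
  rw [h, trace_kronecker]
  simp

/-- The bound on the result of a cheating Alice who announced the bit `a`. -/
theorem sum_jointProb_bob_extend_le (Q : Protocol) {w : ℝ} (hw : w < 2) (hA : Q.weakCheatA ≤ w)
    (p : unitInterval) (hp : (p : ℝ) = max 0 ((1 - w) / (2 - w))) (a c : Fin 2) {m : Reg}
    (A : AliceStrategy (Q.rounds ++ [(emptyReg, bitReg)]) m) {α : Matrix m m ℂ}
    (hα : α.PosSemidef) :
    ∑ cA, jointProb A (Q.bob.strategy.extend p) (withSide (Equiv.prodAssoc m Q.bob.mem _).symm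
        (bitState a) (α ⊗ₖ Q.bob.init.mat)) cA (some c) ≤ 1 / (2 - w) * α.trace.re := by
  have hρ : (α ⊗ₖ Q.bob.init.mat).PosSemidef := hα.kronecker Q.bob.init.pos
  rw [sum_jointProb_bob_extend, Fintype.sum_option, Fin.sum_univ_two, bobOutputWeight_none,
    bobOutputWeight_zero, bobOutputWeight_one]
  have ht : 0 ≤ α.trace.re := (Complex.le_def.1 hα.trace_nonneg).1
  have hq := jointProb_le_trace (A.truncate (some 0) Q.rounds) Q.bob.strategy hρ (some 0)
  rw [trace_kronecker, Q.bob.init.trace_eq_one, mul_one, Fintype.sum_option,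
    Fin.sum_univ_two] at hq
  have h0 := jointProb_le_weakCheatA Q (A.truncate (some 0) Q.rounds) hα
  have hn := jointProb_nonneg (A.truncate (some 0) Q.rounds) Q.bob.strategy hρ (some 0)
  have hn0 := hn (some 0)
  have hn1 := hn (some 1)
  have hnn := hn none
  set q0 := jointProb (A.truncate (some 0) Q.rounds) Q.bob.strategy (α ⊗ₖ Q.bob.init.mat)
    (some 0) (some 0)
  set q1 := jointProb (A.truncate (some 0) Q.rounds) Q.bob.strategy (α ⊗ₖ Q.bob.init.mat)
    (some 0) (some 1)
  set t := α.trace.re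
  have h0w : q0 ≤ w * t := h0.trans (mul_le_mul_of_nonneg_right hA ht)
  have hw' : 0 < 2 - w := by linarith
  obtain ⟨K, hK⟩ : ∃ K, K = 1 / (2 - w) := ⟨_, rfl⟩
  have hKw : K * (2 - w) = 1 := by rw [hK]; field_simp
  rw [← hK]
  rcases le_total w 1 with h1 | h1
  -- With `p = 1 - K`, the case `c = a` reads `q0 + p * q1 = K * q0 + (1 - K) * (q0 + q1)`. The
  -- bounds `q0 ≤ w * t` and `q0 + q1 ≤ t`, with `K * w = 2 * K - 1`, give `K * t`. For `c ≠ a` the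
  -- value is `K * q1`.
  · have hpK : (p : ℝ) = 1 - K := by
      rw [hp, max_eq_right (div_nonneg (by linarith) hw'.le), hK]
      field_simp
      ring
    have hp0 : 0 ≤ 1 - K := hpK ▸ p.2.1
    have hK0 : 0 ≤ K := by rw [hK]; positivity
    rw [hpK]
    split_ifs
    · have e1 : K * q0 ≤ K * (w * t) := mul_le_mul_of_nonneg_left h0w hK0
      have e2 : (1 - K) * (q0 + q1) ≤ (1 - K) * t :=
        mul_le_mul_of_nonneg_left (by linarith) hp0
      have e3 : K * (w * t) = (2 * K - 1) * t := by
        linear_combination -t * hKw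
      linarith
    · have e1 : K * q1 ≤ K * t := mul_le_mul_of_nonneg_left (by linarith) hK0
      linarith
  -- Here `K ≥ 1`, so bounding the probability by `t` suffices.
  · have hp0 : (p : ℝ) = 0 := by
      rw [hp, max_eq_left (div_nonpos_of_nonpos_of_nonneg (by linarith) hw'.le)]
    have hK1 : 1 ≤ K := by rw [hK, le_div_iff₀ hw']; linarith
    have e1 : t ≤ K * t := le_mul_of_one_le_left ht hK1
    rw [hp0]
    split_ifs <;> linarith

theorem prob_strongBob_le (Q : Protocol) {w : ℝ} (hw : w < 2) (hA : Q.weakCheatA ≤ w)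
    (p : unitInterval) (hp : (p : ℝ) = max 0 ((1 - w) / (2 - w)))
    (A : Alice (Q.strong p).rounds) (c : Fin 2) :
    prob A (Q.strong p).bob (some c) ≤ 1 / (2 - w) := by
  obtain ⟨m, α, _ | ⟨send, receive, rest⟩⟩ := A
  rw [prob_some]
  change jointProb (.round send receive rest) (strongBob p Q.bob).strategy
    (α.mat ⊗ₖ (strongBob p Q.bob).init.mat) (some c) (some c) ≤ _
  rw [jointProb_strongBob]
  calc _ ≤ ∑ a, 1 / (2 - w) * (aliceSendState α.mat send receive a).trace.re := by
        refine Finset.sum_le_sum fun a _ => ?_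
        have hρ := aliceSendState_posSemidef α.pos send receive a
        -- Dropping the requirement that Alice's output agrees only increases the probability.
        refine le_trans ?_ (sum_jointProb_bob_extend_le Q hw hA p hp a c rest hρ)
        exact Finset.single_le_sum (f := fun cA => jointProb rest (Q.bob.strategy.extend p) _ cA _)
          (fun cA _ => jointProb_nonneg _ _ (withSide_posSemidef _ (bitState_posSemidef a)
            (hρ.kronecker Q.bob.init.pos)) _ _) (Finset.mem_univ (some c))
    _ = 1 / (2 - w) := by
        rw [← Finset.mul_sum, ← Complex.re_sum, sum_trace_aliceSendState, α.trace_eq_one]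
        simp

theorem prob_strongAlice_le (Q : Protocol) {v : ℝ} (hB : Q.weakCheatB ≤ v)
    (p : unitInterval) (B : Bob (Q.strong p).rounds) (c : Fin 2) :
    prob (Q.strong p).alice B (some c) ≤ (1 + v) / 2 := by
  obtain ⟨n, β, _ | ⟨reply, rest⟩⟩ := B
  rw [prob_some]
  change jointProb (strongAlice Q.alice).strategy (.round reply rest)
    ((strongAlice Q.alice).init.mat ⊗ₖ β.mat) (some c) (some c) ≤ _
  rw [jointProb_strongAlice]
  have hρ : ∀ a, (Q.alice.init.mat ⊗ₖ (bobReplyState β reply a).mat).PosSemidef := fun a =>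
    Q.alice.init.pos.kronecker (bobReplyState β reply a).pos
  calc _ ≤ ∑ a, 1 / 2 * (if a = c then 1 else v) := by
        refine Finset.sum_le_sum fun a _ => mul_le_mul_of_nonneg_left ?_ (by norm_num)
        have hσ := withSide_posSemidef (swapRight Q.alice.mem (Fin 2) _)
          (bitState_posSemidef a) (hρ a)
        refine le_trans (Finset.single_le_sum
          (f := fun cB => jointProb Q.alice.strategy.extend rest _ _ cB)
          (fun cB _ => jointProb_nonneg _ _ hσ _ _) (Finset.mem_univ (some c))) ?_
        -- If `a = c`, the trivial bound `1` is used; if `a ≠ c`, Bob has to win `Q`.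
        split_ifs with h
        · refine (jointProb_le_trace _ _ hσ _).trans_eq ?_
          rw [trace_withSide_bitState, trace_kronecker, Q.alice.init.trace_eq_one,
            (bobReplyState β reply a).trace_eq_one]
          simp
        · refine (sum_jointProb_alice_extend_le (Ne.symm h) Q.alice.strategy rest (hρ a)).trans ?_
          exact (jointProb_le_weakCheatB Q (rest.truncate (some 1) Q.rounds)
            (bobReplyState β reply a)).trans hB
    _ = (1 + v) / 2 := by
        fin_cases c <;> simp [Fin.sum_univ_two] <;> ring

/-- If Bob is honest, then after the first round he holds his memory and the announced bit. -/
theorem bobReplyState_strongBob {n : Type} [Fintype n] [DecidableEq n] (β : Density n)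
    (a : Fin 2) :
    (bobReplyState β (((Channel.function (fun a : Fin 2 => a)).tensorId n).reindex
        (Equiv.prodComm _ _) ((Equiv.prodPUnit _).trans (Equiv.prodComm _ _))) a).mat
      = β.mat ⊗ₖ bitState a := by
  have h : (((Channel.function (fun a : Fin 2 => a)).tensorId n).reindex
        (Equiv.prodComm _ _) ((Equiv.prodPUnit (n × Fin 2)).trans (Equiv.prodComm _ _))).map
        (β.mat ⊗ₖ bitState a)
      = (β.mat ⊗ₖ bitState a).submatrix (fun i => i.1) (fun i => i.1) := by
    have h1 : β.mat ⊗ₖ bitState a = (bitState a ⊗ₖ β.mat).submatrix (Equiv.prodComm n (Fin 2))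
        (Equiv.prodComm n (Fin 2)) := by
      ext ⟨i, b⟩ ⟨j, b'⟩
      simp [kroneckerMap_apply, mul_comm]
    rw [h1]
    refine (sum_kraus_submatrix (fun i => (Channel.function (fun a : Fin 2 => a)).K i
      ⊗ₖ (1 : Matrix n n ℂ)) _ (Equiv.prodComm n (Fin 2))
      ((Equiv.prodPUnit (n × Fin 2)).trans (Equiv.prodComm _ _)) (fun i => rfl) _).trans ?_
    change ((Channel.function (fun a : Fin 2 => a)).apply _).submatrix _ _ = _
    rw [Channel.function_apply_eq_sum, Finset.sum_eq_single a]
    · ext ⟨⟨i, b⟩, j⟩ ⟨⟨i', b'⟩, j'⟩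
      simp [kroneckerMap_apply]
    · intro b _ hb
      ext x y
      simp [kroneckerMap_apply, hb.symm]
    · simp
  simp only [bobReplyState]
  rw [h]
  rfl

theorem prob_strong_honest (Q : Protocol) {z : ℝ} (h0 : prob Q.alice Q.bob (some 0) = z)
    (h1 : prob Q.alice Q.bob (some 1) = 1 - z) (p : unitInterval) (c : Fin 2) :
    prob (Q.strong p).alice (Q.strong p).bob (some c) = 1 / 2 := by
  rw [prob_some] at h0 h1 ⊢
  have hρ : (Q.alice.init.mat ⊗ₖ Q.bob.init.mat).PosSemidef :=
    Q.alice.init.pos.kronecker Q.bob.init.pos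
  have hsum := sum_jointProb Q.alice.strategy Q.bob.strategy
    (Q.alice.init.mat ⊗ₖ Q.bob.init.mat)
  rw [trace_kronecker, Q.alice.init.trace_eq_one, Q.bob.init.trace_eq_one] at hsum
  have hn := jointProb_nonneg Q.alice.strategy Q.bob.strategy hρ
  change jointProb (strongAlice Q.alice).strategy (.round _ (Q.bob.strategy.extend p))
    ((strongAlice Q.alice).init.mat ⊗ₖ Q.bob.init.mat) (some c) (some c) = _
  rw [jointProb_strongAlice]
  have ha : ∀ a, jointProb Q.alice.strategy.extend (Q.bob.strategy.extend p)
      (withSide (swapRight Q.alice.mem (Fin 2) (Q.bob.mem × Fin 2)) (bitState a)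
        (Q.alice.init.mat ⊗ₖ (Q.bob.init.mat ⊗ₖ bitState a))) (some c) (some c)
      = z * (if c = a then 1 else 0) + (1 - z) * (if c = a then (p : ℝ) else 1 - p) := by
    intro a
    have hs : Q.alice.init.mat ⊗ₖ (Q.bob.init.mat ⊗ₖ bitState a)
        = withSide (Equiv.prodAssoc Q.alice.mem Q.bob.mem (Fin 2)).symm (bitState a)
          (Q.alice.init.mat ⊗ₖ Q.bob.init.mat) := by
      ext ⟨i, j, b⟩ ⟨i', j', b'⟩
      simp only [kroneckerMap_apply, withSide, submatrix_apply, Equiv.prodAssoc_symm_apply]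
      ring
    rw [hs, jointProb_extend, ← honestWeight_zero p a c, ← honestWeight_one p a c]
    generalize jointProb Q.alice.strategy Q.bob.strategy
      (Q.alice.init.mat ⊗ₖ Q.bob.init.mat) = q at *
    simp only [Fintype.sum_option, Fin.sum_univ_two, mul_one, Complex.one_re] at hsum ⊢
    -- The pairs `(0, 0)` and `(1, 1)` already carry total probability `z + (1 - z) = 1`, so the
    -- other seven, being nonnegative, vanish.
    obtain ⟨e1, e2, e3, e4, e5, e6, e7⟩ : q none none = 0 ∧ q none (some 0) = 0
        ∧ q none (some 1) = 0 ∧ q (some 0) none = 0 ∧ q (some 0) (some 1) = 0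
        ∧ q (some 1) none = 0 ∧ q (some 1) (some 0) = 0 := by
      refine ⟨?_, ?_, ?_, ?_, ?_, ?_, ?_⟩ <;>
      linarith [hn none none, hn none (some 0), hn none (some 1), hn (some 0) none,
        hn (some 0) (some 1), hn (some 1) none, hn (some 1) (some 0)]
    simp only [e1, e2, e3, e4, e5, e6, e7, h0, h1]
    ring
  have hb := fun a => bobReplyState_strongBob Q.bob.init a
  calc _ = ∑ a, 1 / 2 * (z * (if c = a then 1 else 0)
        + (1 - z) * (if c = a then (p : ℝ) else 1 - p)) := by
        refine Finset.sum_congr rfl fun a _ => ?_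
        rw [← ha a, ← hb a]
    _ = 1 / 2 := by
        fin_cases c <;> simp [Fin.sum_univ_two] <;> ring

end CoinFlip

theorem mainTheorem3 (Q : CoinFlip.Protocol) (z ε : ℝ) (hQ : Q.IsWCF z ε) (hzε : z + ε < 2) :
    ∃ p : unitInterval, (p : ℝ) = max 0 ((1 - z - ε) / (2 - z - ε)) ∧
      (Q.strong p).numRounds = Q.numRounds + 2 ∧
      (Q.strong p).IsSCF (max (1 / (2 - z - ε)) ((2 - z + ε) / 2) - 1 / 2) ∧
      (Q.strong p).strongCheatA ≤ 1 / (2 - z - ε) ∧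
      (Q.strong p).strongCheatB ≤ (2 - z + ε) / 2 := by
  have hpos : 0 < 2 - z - ε := by linarith
  let p : unitInterval := ⟨max 0 ((1 - z - ε) / (2 - z - ε)), le_max_left _ _,
    max_le zero_le_one ((div_le_one hpos).2 (by linarith))⟩
  have hp : (p : ℝ) = max 0 ((1 - (z + ε)) / (2 - (z + ε))) := by
    simp only [p, sub_sub]
  have hA : (Q.strong p).strongCheatA ≤ 1 / (2 - z - ε) := by
    have : Nonempty (CoinFlip.Alice (Q.strong p).rounds) := ⟨(Q.strong p).alice⟩
    rw [sub_sub]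
    exact ciSup_le fun A => max_le
      (CoinFlip.prob_strongBob_le Q hzε hQ.cheatA_le p hp A 0)
      (CoinFlip.prob_strongBob_le Q hzε hQ.cheatA_le p hp A 1)
  have hB : (Q.strong p).strongCheatB ≤ (2 - z + ε) / 2 := by
    have : Nonempty (CoinFlip.Bob (Q.strong p).rounds) := ⟨(Q.strong p).bob⟩
    -- The bound of `prob_strongAlice_le` with `v = 1 - z + ε`.
    have h : (2 - z + ε) / 2 = (1 + (1 - z + ε)) / 2 := by ring
    rw [h]
    exact ciSup_le fun B => max_le
      (CoinFlip.prob_strongAlice_le Q hQ.cheatB_le p B 0)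
      (CoinFlip.prob_strongAlice_le Q hQ.cheatB_le p B 1)
  refine ⟨p, rfl, ?_, ⟨?_, ?_, ?_, ?_⟩, hA, hB⟩
  · simp [CoinFlip.Protocol.numRounds, CoinFlip.Protocol.strong]
  · exact CoinFlip.prob_strong_honest Q hQ.honest_alice_wins hQ.honest_bob_wins p 0
  · exact CoinFlip.prob_strong_honest Q hQ.honest_alice_wins hQ.honest_bob_wins p 1
  · rw [add_sub_cancel]
    exact hA.trans (le_max_left _ _)
  · rw [add_sub_cancel]
    exact hB.trans (le_max_right _ _)
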